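/- Let $\mathcal{E}$ be a weakly idempotent complete exact category in the sense of Quillen (weakly idempotent complete: every retraction has a kernel), let $\mathcal{M}\subset\mathcal{E}$ be a full additive subcategory, let $1\le k\le\infty$, and let $X\in\mathcal{E}$. Notation. Right (left) $\mathcal{M}$-modules are contravariant (covariant) additive functors from $\mathcal{M}$ to abelian groups, and $\mathrm{mod}_k\text{-}\mathcal{M}$ (resp. $\mathcal{M}\text{-}\mathrm{mod}_k$) consists of the right (resp. left) $\mathcal{M}$-modules $F$ that admit an exact sequence $Q_k\to\cdots\to Q_0\to F\to 0$ with all $Q_i$ finitely generated projective. Put $\Phi(Y)=\mathrm{Hom}_{\mathcal{E}}(-,Y)|_{\mathcal{M}}$ (a right module) and $\Psi(Y)=\mathrm{Hom}_{\mathcal{E}}(Y,-)|_{\mathcal{M}}$ (a left module). The groups $\mathrm{Tor}^i_{\mathcal{M}}(F,G)$ are the left derived functors of the tensor product $F\otimes_{\mathcal{M}}G$ of a right and a left $\mathcal{M}$-module. The subcategory $\mathrm{gen}_k^{\mathcal{E}}(\mathcal{M})$ consists of the objects $Y$ for which there is an exact sequence $0\to Z\to M_k\to\cdots\to M_0\to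 Y\to 0$ in $\mathcal{E}$ with all $M_i\in\mathcal{M}$ such that $\mathrm{Hom}_{\mathcal{E}}(M,M_k)\to\cdots\to\mathrm{Hom}_{\mathcal{E}}(M,M_0)\to\mathrm{Hom}_{\mathcal{E}}(M,Y)\to 0$ is exact for every $M\in\mathcal{M}$. Dually, $\mathrm{cogen}^k_{\mathcal{E}}(\mathcal{M})$ consists of the objects $Y$ for which there is an exact sequence $0\to Y\to M_0\to\cdots\to M_k\to Z\to 0$ in $\mathcal{E}$ with all $M_i\in\mathcal{M}$ such that $\mathrm{Hom}_{\mathcal{E}}(M_k,M)\to\cdots\to\mathrm{Hom}_{\mathcal{E}}(M_0,M)\to\mathrm{Hom}_{\mathcal{E}}(Y,M)\to 0$ is exact for every $M\in\mathcal{M}$. For $k=\infty$ the sequences are infinite ($\cdots\to Q_1\to Q_0\to F\to 0$, $\cdots\to M_1\to M_0\to Y\to 0$ and $0\to Y\to M_0\to M_1\to\cdots$). An exact sequence in $\mathcal{E}$ is one that is spliced together from conflations. (1) Suppose that $\mathcal{E}$ has enough projectives, and let $\mathcal{P}$ be the class of its projective objects. Then $X\in\mathrm{gen}_k^{\mathcal{E}}(\mathcal{M})$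 if and only if $\Phi(X)\in\mathrm{mod}_k\text{-}\mathcal{M}$ and, for every $P\in\mathcal{P}$, the composition map $$\Phi(X)\otimes_{\mathcal{M}}\Psi(P)\to\mathrm{Hom}_{\mathcal{E}}(P,X),\qquad g\otimes f\mapsto g\circ f,$$ is an isomorphism and $\mathrm{Tor}^i_{\mathcal{M}}(\Phi(X),\Psi(P))=0$ for $1\le i<k$. (2) Suppose that $\mathcal{E}$ has enough injectives, and let $\mathcal{I}$ be the class of its injective objects. Then $X\in\mathrm{cogen}^k_{\mathcal{E}}(\mathcal{M})$ if and only if $\Psi(X)\in\mathcal{M}\text{-}\mathrm{mod}_k$ and, for every $I\in\mathcal{I}$, the composition map $$\Phi(I)\otimes_{\mathcal{M}}\Psi(X)\to\mathrm{Hom}_{\mathcal{E}}(X,I),\qquad g\otimes f\mapsto g\circ f,$$ is an isomorphism and $\mathrm{Tor}^i_{\mathcal{M}}(\Phi(I),\Psi(X))=0$ for $1\le i<k$. -/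

import Mathlib

open CategoryTheory CategoryTheory.Limits

universe v u u'

/-! ### Exact categories -/

section Exact

variable (E : Type u) [Category.{v} E] [Preadditive E]

/-- An exact structure (in the sense of Quillen) on an additive category: a class of
kernel-cokernel pairs, the conflations `A ↣ B ↠ C`, closed under isomorphism, whose
first maps are the inflations and whose second maps are the deflations. -/
structure ExactStructure where
  /-- the conflations -/
  Conflation : ShortComplex E → Prop
  of_iso : ∀ {S T : ShortComplex E}, (S ≅ T) → Conflation S → Conflation T
  isKernel : ∀ {S : ShortComplex E}, Conflation S →
    Nonempty (IsLimit (KernelFork.ofι S.f S.zero))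
  isCokernel : ∀ {S : ShortComplex E}, Conflation S →
    Nonempty (IsColimit (CokernelCofork.ofπ S.g S.zero))
  id_inflation : ∀ A : E, ∃ (C : E) (p : A ⟶ C) (w : 𝟙 A ≫ p = 0),
    Conflation (ShortComplex.mk (𝟙 A) p w)
  id_deflation : ∀ A : E, ∃ (K : E) (i : K ⟶ A) (w : i ≫ 𝟙 A = 0),
    Conflation (ShortComplex.mk i (𝟙 A) w)
  comp_inflation : ∀ {A B C : E} (i : A ⟶ B) (j : B ⟶ C),
    (∃ (D : E) (p : B ⟶ D) (w : i ≫ p = 0), Conflation (ShortComplex.mk i p w)) →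
    (∃ (D : E) (p : C ⟶ D) (w : j ≫ p = 0), Conflation (ShortComplex.mk j p w)) →
    ∃ (D : E) (p : C ⟶ D) (w : (i ≫ j) ≫ p = 0), Conflation (ShortComplex.mk (i ≫ j) p w)
  comp_deflation : ∀ {A B C : E} (p : A ⟶ B) (q : B ⟶ C),
    (∃ (K : E) (i : K ⟶ A) (w : i ≫ p = 0), Conflation (ShortComplex.mk i p w)) →
    (∃ (K : E) (i : K ⟶ B) (w : i ≫ q = 0), Conflation (ShortComplex.mk i q w)) →
    ∃ (K : E) (i : K ⟶ A) (w : i ≫ p ≫ q = 0), Conflation (ShortComplex.mk i (p ≫ q) w)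
  pushout_inflation : ∀ {A B A' : E} (i : A ⟶ B) (f : A ⟶ A'),
    (∃ (D : E) (p : B ⟶ D) (w : i ≫ p = 0), Conflation (ShortComplex.mk i p w)) →
    ∃ (B' : E) (i' : A' ⟶ B') (f' : B ⟶ B'), IsPushout i f f' i' ∧
      ∃ (D : E) (p : B' ⟶ D) (w : i' ≫ p = 0), Conflation (ShortComplex.mk i' p w)
  pullback_deflation : ∀ {B C C' : E} (p : B ⟶ C) (f : C' ⟶ C),
    (∃ (K : E) (i : K ⟶ B) (w : i ≫ p = 0), Conflation (ShortComplex.mk i p w)) →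
    ∃ (B' : E) (p' : B' ⟶ C') (f' : B' ⟶ B), IsPullback f' p' p f ∧
      ∃ (K : E) (i : K ⟶ B') (w : i ≫ p' = 0), Conflation (ShortComplex.mk i p' w)

/-- Every retraction has a kernel (equivalently, every coretraction has a cokernel). -/
def WeaklyIdempotentComplete : Prop :=
  ∀ ⦃A B : E⦄ (r : A ⟶ B) (s : B ⟶ A), s ≫ r = 𝟙 B → HasKernel r

variable {E}

namespace ExactStructure

variable (S : ExactStructure E)

/-- `i` is the first map of a conflation. -/
def Inflation {A B : E} (i : A ⟶ B) : Prop :=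
  ∃ (C : E) (p : B ⟶ C) (w : i ≫ p = 0), S.Conflation (ShortComplex.mk i p w)

/-- `p` is the second map of a conflation. -/
def Deflation {B C : E} (p : B ⟶ C) : Prop :=
  ∃ (A : E) (i : A ⟶ B) (w : i ≫ p = 0), S.Conflation (ShortComplex.mk i p w)

/-- `P` is projective: maps out of `P` lift along deflations. -/
def IsProjective (P : E) : Prop :=
  ∀ ⦃B C : E⦄ (p : B ⟶ C), S.Deflation p → ∀ f : P ⟶ C, ∃ g : P ⟶ B, g ≫ p = f

/-- `I` is injective: maps into `I` extend along inflations. -/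
def IsInjective (I : E) : Prop :=
  ∀ ⦃A B : E⦄ (i : A ⟶ B), S.Inflation i → ∀ f : A ⟶ I, ∃ g : B ⟶ I, i ≫ g = f

/-- Every object is the target of a deflation from a projective object. -/
def HasEnoughProjectives : Prop :=
  ∀ X : E, ∃ (P : E) (p : P ⟶ X), S.IsProjective P ∧ S.Deflation p

/-- Every object is the source of an inflation into an injective object. -/
def HasEnoughInjectives : Prop :=
  ∀ X : E, ∃ (I : E) (i : X ⟶ I), S.IsInjective I ∧ S.Inflation i

/-- An exact sequence `0 → Z (k+1) → A k → ⋯ → A 1 → A 0 → X → 0` in the exact category, given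
by the conflations `Z (i+1) ↣ A i ↠ Z i`, `i ≤ k`, into which it decomposes, with `Z 0 ≅ X`.
For `k = ⊤` it is an exact sequence `⋯ → A 1 → A 0 → X → 0`. The terms that do not occur
in the sequence are irrelevant. -/
structure LeftSequence (k : ℕ∞) (X : E) where
  /-- the terms -/
  A : ℕ → E
  /-- the syzygies -/
  Z : ℕ → E
  /-- the last syzygy is `X` -/
  e : Z 0 ≅ X
  /-- the inflations -/
  ι : ∀ i, Z (i + 1) ⟶ A i
  /-- the deflations -/
  π : ∀ i, A i ⟶ Z i
  w : ∀ i, ι i ≫ π i = 0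
  conflation : ∀ i : ℕ, (i : ℕ∞) ≤ k → S.Conflation (ShortComplex.mk (ι i) (π i) (w i))

namespace LeftSequence

variable {S} {k : ℕ∞} {X : E} (T : S.LeftSequence k X)

/-- The map `A 0 → X`. -/
def aug : T.A 0 ⟶ X := T.π 0 ≫ T.e.hom

/-- The map `A (i+1) → A i`. -/
def d (i : ℕ) : T.A (i + 1) ⟶ T.A i := T.π (i + 1) ≫ T.ι i

end LeftSequence

/-- An exact sequence `0 → X → A 0 → A 1 → ⋯ → A k → Z (k+1) → 0` in the exact category, given
by the conflations `Z i ↣ A i ↠ Z (i+1)`, `i ≤ k`, into which it decomposes, with `X ≅ Z 0`.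
For `k = ⊤` it is an exact sequence `0 → X → A 0 → A 1 → ⋯`. -/
structure RightSequence (k : ℕ∞) (X : E) where
  /-- the terms -/
  A : ℕ → E
  /-- the cosyzygies -/
  Z : ℕ → E
  /-- the first cosyzygy is `X` -/
  e : X ≅ Z 0
  /-- the inflations -/
  ι : ∀ i, Z i ⟶ A i
  /-- the deflations -/
  π : ∀ i, A i ⟶ Z (i + 1)
  w : ∀ i, ι i ≫ π i = 0
  conflation : ∀ i : ℕ, (i : ℕ∞) ≤ k → S.Conflation (ShortComplex.mk (ι i) (π i) (w i))

namespace RightSequence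

variable {S} {k : ℕ∞} {X : E} (T : S.RightSequence k X)

/-- The map `X → A 0`. -/
def coaug : X ⟶ T.A 0 := T.e.hom ≫ T.ι 0

/-- The map `A i → A (i+1)`. -/
def d (i : ℕ) : T.A i ⟶ T.A (i + 1) := T.π i ≫ T.ι (i + 1)

end RightSequence

/-- The full subcategory `gen_k(M)`: objects `X` with an exact sequence
`0 → Z → A k → ⋯ → A 0 → X → 0`, all `A i` in `M`, such that for all `N` in `M` the sequence
`Hom(N, A k) → ⋯ → Hom(N, A 0) → Hom(N, X) → 0` is exact. -/
def gen (k : ℕ∞) (M : ObjectProperty E) : ObjectProperty E := fun X =>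
  ∃ T : S.LeftSequence k X, (∀ i : ℕ, (i : ℕ∞) ≤ k → M (T.A i)) ∧
    ∀ N : E, M N →
      Function.Surjective (fun f : N ⟶ T.A 0 => f ≫ T.aug) ∧
      (0 < k → Function.Exact (fun f : N ⟶ T.A 1 => f ≫ T.d 0)
        (fun f : N ⟶ T.A 0 => f ≫ T.aug)) ∧
      ∀ i : ℕ, ((i + 1 : ℕ) : ℕ∞) < k →
        Function.Exact (fun f : N ⟶ T.A (i + 2) => f ≫ T.d (i + 1))
          (fun f : N ⟶ T.A (i + 1) => f ≫ T.d i)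

/-- The full subcategory `cogen^k(M)`: objects `X` with an exact sequence
`0 → X → A 0 → ⋯ → A k → Z → 0`, all `A i` in `M`, such that for all `N` in `M` the sequence
`Hom(A k, N) → ⋯ → Hom(A 0, N) → Hom(X, N) → 0` is exact. -/
def cogen (k : ℕ∞) (M : ObjectProperty E) : ObjectProperty E := fun X =>
  ∃ T : S.RightSequence k X, (∀ i : ℕ, (i : ℕ∞) ≤ k → M (T.A i)) ∧
    ∀ N : E, M N →
      Function.Surjective (fun f : T.A 0 ⟶ N => T.coaug ≫ f) ∧
      (0 < k → Function.Exact (fun f : T.A 1 ⟶ N => T.d 0 ≫ f)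
        (fun f : T.A 0 ⟶ N => T.coaug ≫ f)) ∧
      ∀ i : ℕ, ((i + 1 : ℕ) : ℕ∞) < k →
        Function.Exact (fun f : T.A (i + 2) ⟶ N => T.d (i + 1) ≫ f)
          (fun f : T.A (i + 1) ⟶ N => T.d i ≫ f)

end ExactStructure

end Exact

/-! ### Modules over a preadditive category -/

/-- The category of left `C`-modules: additive functors from `C` to abelian groups. Right
`C`-modules are left `Cᵒᵖ`-modules. The abelian groups live in a universe that contains both
the objects and the morphisms of `C`, so that `C` need not be essentially small. -/
abbrev LeftMod (C : Type u) [Category.{v} C] [Preadditive C] :=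
  C ⥤+ AddCommGrpCat.{max u v}

/-- The category of right `C`-modules: contravariant additive functors to abelian groups. -/
abbrev RightMod (C : Type u) [Category.{v} C] [Preadditive C] := LeftMod.{v, u} Cᵒᵖ

section Modules

variable {C : Type u} [Category.{v} C] [Preadditive C]

section Abelian

variable (C) (D : Type u') [Category.{max u v} D] [Abelian D]

instance : (additiveFunctor C D).IsClosedUnderSubobjects where
  prop_of_mono {F G} i _ hG := by
    have : G.Additive := hG
    exact ⟨fun {X Y f g} => by
      rw [← cancel_mono (i.app Y)]
      simp [Preadditive.add_comp, Preadditive.comp_add]⟩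

instance : (additiveFunctor C D).IsClosedUnderQuotients where
  prop_of_epi {F G} p _ hF := by
    have : F.Additive := hF
    exact ⟨fun {X Y f g} => by
      rw [← cancel_epi (p.app X)]
      simp [← NatTrans.naturality, Preadditive.add_comp, Preadditive.comp_add]⟩

instance : (additiveFunctor C D).ContainsZero where
  exists_zero := ⟨_, isZero_zero (C ⥤ D), Functor.Additive.of_isZero (isZero_zero _)⟩

instance : (additiveFunctor C D).IsClosedUnderFiniteProducts where
  isClosedUnderLimitsOfShape J _ := by
    refine ⟨?_⟩
    rintro F ⟨h⟩
    refine ⟨fun {X Y f g} => ?_⟩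
    refine (isLimitOfPreserves ((evaluation C D).obj Y) h.isLimit).hom_ext fun j => ?_
    have : (h.diag.obj j).Additive := h.prop_diag_obj j
    simp [Preadditive.add_comp]

instance (J : Type (max u v)) [HasCoproducts.{max u v} D] :
    (additiveFunctor C D).IsClosedUnderColimitsOfShape (Discrete J) := by
  refine ⟨?_⟩
  rintro F ⟨h⟩
  refine ⟨fun {X Y f g} => ?_⟩
  refine (isColimitOfPreserves ((evaluation C D).obj X) h.isColimit).hom_ext fun j => ?_
  have : (h.diag.obj j).Additive := h.prop_diag_obj j
  simp [← NatTrans.naturality, Preadditive.comp_add]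

end Abelian

/-- For an additive functor `J : C ⥤ E`, the left `C`-module `c ↦ Hom(X, J c)`. -/
def homFrom {E : Type u'} [Category.{v} E] [Preadditive E] (J : C ⥤ E) [J.Additive] (X : E) :
    LeftMod.{v, u} C where
  obj :=
    { obj := fun c => AddCommGrpCat.of (ULift.{max u v} (X ⟶ J.obj c))
      map := fun {_ _} f => AddCommGrpCat.ofHom
        { toFun := fun g => ⟨g.down ≫ J.map f⟩
          map_zero' := by ext; simp
          map_add' := fun _ _ => by ext; simp [Preadditive.add_comp] }
      map_id := fun _ => by ext; simp
      map_comp := fun _ _ => by ext; simp }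
  property := ⟨fun {_ _ _ _} => by ext; simp [Preadditive.comp_add]⟩

/-- For an additive functor `J : C ⥤ E`, the right `C`-module `c ↦ Hom(J c, X)`. -/
def homTo {E : Type u'} [Category.{v} E] [Preadditive E] (J : C ⥤ E) [J.Additive] (X : E) :
    RightMod.{v, u} C where
  obj :=
    { obj := fun c => AddCommGrpCat.of (ULift.{max u v} (J.obj c.unop ⟶ X))
      map := fun {_ _} f => AddCommGrpCat.ofHom
        { toFun := fun g => ⟨J.map f.unop ≫ g.down⟩
          map_zero' := by ext; simp
          map_add' := fun _ _ => by ext; simp [Preadditive.comp_add] }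
      map_id := fun _ => by ext; simp
      map_comp := fun _ _ => by ext; simp }
  property := ⟨fun {_ _ _ _} => by ext; simp [Preadditive.add_comp]⟩

/-- The map `Hom(c, -) ⟶ F` given by an element of `F c`. -/
def ofElement (F : LeftMod.{v, u} C) (c : C) (x : F.obj.obj c) : homFrom (𝟭 C) c ⟶ F :=
  ObjectProperty.homMk
    { app := fun d => AddCommGrpCat.ofHom
        { toFun := fun g => F.obj.map g.down x
          map_zero' := by simp
          map_add' := fun _ _ => by simp }
      naturality := fun _ _ f => by
        ext g
        change F.obj.map (g.down ≫ f) x = F.obj.map f (F.obj.map g.down x)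
        simp }

lemma leftMod_epi_iff {F G : LeftMod.{v, u} C} (p : F ⟶ G) :
    Epi p ↔ ∀ c, Function.Surjective (p.hom.app c) := by
  have := (additiveFunctor C AddCommGrpCat.{max u v}).preservesEpimorphisms_ι_of_isNormalMonoCategory
  have h : Epi p ↔ Epi p.hom :=
    ⟨fun _ => inferInstanceAs (Epi ((additiveFunctor C AddCommGrpCat.{max u v}).ι.map p)),
     fun h => (additiveFunctor C AddCommGrpCat.{max u v}).ι.epi_of_epi_map h⟩
  rw [h, NatTrans.epi_iff_epi_app]
  simp only [AddCommGrpCat.epi_iff_surjective]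

instance (c : C) : Projective (homFrom (𝟭 C) c) where
  factors {F G} f p hp := by
    rw [leftMod_epi_iff] at hp
    obtain ⟨y, hy⟩ := hp c (f.hom.app c ⟨𝟙 c⟩)
    refine ⟨ofElement F c y, ?_⟩
    ext d g
    change p.hom.app d (F.obj.map g.down y) = f.hom.app d g
    have h₁ := ConcreteCategory.congr_hom (p.hom.naturality g.down) y
    have h₂ := ConcreteCategory.congr_hom (f.hom.naturality g.down) ⟨𝟙 c⟩
    refine h₁.trans ((congrArg (G.obj.map g.down) hy).trans (h₂.symm.trans ?_))
    exact congrArg (f.hom.app d) (ULift.ext _ _ (Category.id_comp _))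

instance : EnoughProjectives (LeftMod.{v, u} C) where
  presentation F := by
    let Q : (Σ c : C, F.obj.obj c) → LeftMod.{v, u} C := fun s => homFrom (𝟭 C) s.1
    refine ⟨{ p := ∐ Q, f := Sigma.desc fun s => ofElement F s.1 s.2, epi := ?_ }⟩
    rw [leftMod_epi_iff]
    intro c x
    refine ⟨(Sigma.ι Q ⟨c, x⟩).hom.app c ⟨𝟙 c⟩, ?_⟩
    have h := ConcreteCategory.congr_hom (NatTrans.congr_app (congrArg (fun f => f.hom)
      (Sigma.ι_desc (fun s => ofElement F s.1 s.2) (⟨c, x⟩ : Σ c : C, F.obj.obj c))) c) ⟨𝟙 c⟩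
    refine h.trans ?_
    change F.obj.map (𝟙 c) x = x
    simp

/-- Finitely generated modules. -/
def LeftMod.FG (F : LeftMod.{v, u} C) : Prop :=
  ∃ (n : ℕ) (c : Fin n → C) (x : ∀ i, F.obj.obj (c i)), ∀ (d : C) (y : F.obj.obj d),
    ∃ f : ∀ i, c i ⟶ d, y = ∑ i, F.obj.map (f i) (x i)

/-- `mod_k`: the modules `F` with a `k`-presentation, that is an exact sequence
`Q k → ⋯ → Q 1 → Q 0 → F → 0`, by finitely generated projectives. For `k = ⊤` this is an exact
sequence `⋯ → Q 1 → Q 0 → F → 0`. -/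
def LeftMod.IsPresented (k : ℕ∞) (F : LeftMod.{v, u} C) : Prop :=
  ∃ (Q : ℕ → LeftMod.{v, u} C) (d : ∀ i, Q (i + 1) ⟶ Q i) (ε : Q 0 ⟶ F),
    (∀ i : ℕ, (i : ℕ∞) ≤ k → Projective (Q i) ∧ (Q i).FG) ∧
    Epi ε ∧
    (0 < k → ∃ w : d 0 ≫ ε = 0, (ShortComplex.mk (d 0) ε w).Exact) ∧
    ∀ i : ℕ, ((i + 1 : ℕ) : ℕ∞) < k →
      ∃ w : d (i + 1) ≫ d i = 0, (ShortComplex.mk (d (i + 1)) (d i) w).Exact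

/-! ### Tensor products and Tor -/

section Tensor

variable (F : RightMod.{v, u} C) (G : LeftMod.{v, u} C)

/-- The relations defining the tensor product: biadditivity, and `x f ⊗ y = x ⊗ f y` for all
`f : c ⟶ d`, `x ∈ F d`, `y ∈ G c`. -/
inductive TensorRel :
    FreeAbelianGroup (Σ c : C, F.obj.obj (Opposite.op c) × G.obj.obj c) → Prop
  | add_left (c : C) (x x' : F.obj.obj (Opposite.op c)) (y : G.obj.obj c) :
      TensorRel (.of ⟨c, x + x', y⟩ - (.of ⟨c, x, y⟩ + .of ⟨c, x', y⟩))
  | add_right (c : C) (x : F.obj.obj (Opposite.op c)) (y y' : G.obj.obj c) :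
      TensorRel (.of ⟨c, x, y + y'⟩ - (.of ⟨c, x, y⟩ + .of ⟨c, x, y'⟩))
  | balanced (c d : C) (f : c ⟶ d) (x : F.obj.obj (Opposite.op d)) (y : G.obj.obj c) :
      TensorRel (.of ⟨c, F.obj.map f.op x, y⟩ - .of ⟨d, x, G.obj.map f y⟩)

/-- The tensor product `F ⊗_C G` of a right and a left `C`-module. -/
abbrev TensorObj : Type (max u v) :=
  FreeAbelianGroup (Σ c : C, F.obj.obj (Opposite.op c) × G.obj.obj c) ⧸
    AddSubgroup.closure {r | TensorRel F G r}

variable {F G}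

/-- The element `x ⊗ y`, for `x ∈ F c` and `y ∈ G c`. -/
def tmul {c : C} (x : F.obj.obj (Opposite.op c)) (y : G.obj.obj c) : TensorObj F G :=
  QuotientAddGroup.mk (FreeAbelianGroup.of ⟨c, x, y⟩)

/-- The homomorphism out of the tensor product given by a balanced biadditive map. -/
def tensorLift {A : Type*} [AddCommGroup A]
    (φ : ∀ c : C, F.obj.obj (Opposite.op c) → G.obj.obj c → A)
    (add_left : ∀ c x x' y, φ c (x + x') y = φ c x y + φ c x' y)
    (add_right : ∀ c x y y', φ c x (y + y') = φ c x y + φ c x y')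
    (balanced : ∀ (c d : C) (f : c ⟶ d) (x : F.obj.obj (Opposite.op d)) (y : G.obj.obj c),
      φ c (F.obj.map f.op x) y = φ d x (G.obj.map f y)) : TensorObj F G →+ A :=
  QuotientAddGroup.lift _ (FreeAbelianGroup.lift fun s => φ s.1 s.2.1 s.2.2) (by
    rw [AddSubgroup.closure_le]
    rintro r (⟨c, x, x', y⟩ | ⟨c, x, y, y'⟩ | ⟨c, d, f, x, y⟩)
    · simp [add_left]
    · simp [add_right]
    · simp [balanced])

@[simp]
lemma tensorLift_tmul {A : Type*} [AddCommGroup A]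
    (φ : ∀ c : C, F.obj.obj (Opposite.op c) → G.obj.obj c → A) (h₁ h₂ h₃) {c : C}
    (x : F.obj.obj (Opposite.op c)) (y : G.obj.obj c) :
    tensorLift φ h₁ h₂ h₃ (tmul x y) = φ c x y := by
  simp [tensorLift, tmul]

lemma tmul_add_left {c : C} (x x' : F.obj.obj (Opposite.op c)) (y : G.obj.obj c) :
    (tmul (x + x') y : TensorObj F G) = tmul x y + tmul x' y :=
  (QuotientAddGroup.eq_iff_sub_mem.2 (AddSubgroup.subset_closure (.add_left c x x' y)))

lemma tmul_add_right {c : C} (x : F.obj.obj (Opposite.op c)) (y y' : G.obj.obj c) :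
    (tmul x (y + y') : TensorObj F G) = tmul x y + tmul x y' :=
  (QuotientAddGroup.eq_iff_sub_mem.2 (AddSubgroup.subset_closure (.add_right c x y y')))

lemma tmul_balanced {c d : C} (f : c ⟶ d) (x : F.obj.obj (Opposite.op d)) (y : G.obj.obj c) :
    (tmul (F.obj.map f.op x) y : TensorObj F G) = tmul x (G.obj.map f y) :=
  (QuotientAddGroup.eq_iff_sub_mem.2 (AddSubgroup.subset_closure (.balanced c d f x y)))

lemma tensor_hom_ext {A : Type*} [AddCommGroup A] {f g : TensorObj F G →+ A}
    (h : ∀ (c : C) (x : F.obj.obj (Opposite.op c)) (y : G.obj.obj c),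
      f (tmul x y) = g (tmul x y)) : f = g := by
  refine QuotientAddGroup.addMonoidHom_ext _ (FreeAbelianGroup.lift_ext _ _ ?_)
  rintro ⟨c, x, y⟩
  exact h c x y

variable (G)

/-- The functor `- ⊗_C G` from right `C`-modules to abelian groups. -/
def tensorRight : RightMod.{v, u} C ⥤ AddCommGrpCat.{max u v} where
  obj F := AddCommGrpCat.of (TensorObj F G)
  map {F F'} α := AddCommGrpCat.ofHom (tensorLift (fun c x y => tmul (α.hom.app _ x) y)
    (fun c x x' y => by simp [tmul_add_left]) (fun c x y y' => by simp [tmul_add_right])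
    (fun c d f x y => by
      rw [← tmul_balanced]
      congr 1
      exact ConcreteCategory.congr_hom (α.hom.naturality f.op) x))
  map_id F := by
    ext : 1
    refine tensor_hom_ext fun c x y => ?_
    simp
  map_comp α β := by
    ext : 1
    refine tensor_hom_ext fun c x y => ?_
    simp

instance : (tensorRight G).Additive where
  map_add {F F' α β} := by
    ext : 1
    refine tensor_hom_ext fun c x y => ?_
    change tmul (α.hom.app _ x + β.hom.app _ x) y = tmul (α.hom.app _ x) y + tmul (β.hom.app _ x) y
    exact tmul_add_left _ _ _

/-- `Tor_i^C(F, G)`: the `i`-th left derived functor of `- ⊗_C G` at `F`. -/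
noncomputable def TorMod (i : ℕ) (F : RightMod.{v, u} C) (G : LeftMod.{v, u} C) :
    AddCommGrpCat.{max u v} :=
  ((tensorRight G).leftDerived i).obj F

end Tensor

end Modules

/-! ### The functors `Φ` and `Ψ` -/

section PhiPsi

variable {E : Type u} [Category.{v} E] [Preadditive E] (M : ObjectProperty E)

/-- The right `M`-module `Φ(X) = Hom(-, X)|_M`. -/
def Phi (X : E) : RightMod.{v, u} M.FullSubcategory := homTo M.ι X

/-- The left `M`-module `Ψ(X) = Hom(X, -)|_M`. -/
def Psi (X : E) : LeftMod.{v, u} M.FullSubcategory := homFrom M.ι X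

/-- The map `Φ(X) ⊗_M Ψ(Y) → Hom(Y, X)`, `g ⊗ f ↦ g ∘ f`, where `g : N ⟶ X` and `f : Y ⟶ N`
with `N` in `M`. -/
def compositionMap (X Y : E) : TensorObj (Phi M X) (Psi M Y) →+ (Y ⟶ X) :=
  tensorLift (fun _ g f => f.down ≫ g.down)
    (fun _ _ _ _ => Preadditive.comp_add _ _ _ _ _ _)
    (fun _ _ _ _ => Preadditive.add_comp _ _ _ _ _ _)
    (fun _ _ _ _ _ => (Category.assoc _ _ _).symm)

end PhiPsi

/-! A complex `⋯ → A 1 → A 0 → X` with terms in `M` can be tested by `Hom(N, -)` for `N` in `M` and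
by `Hom(P, -)` for `P` projective in `E`. Part (1) comes from reading each test in two ways; `X`
lies in `gen_k` exactly when some complex passes both in the range given by `k`.

The test with projectives decides whether the complex is spliced from conflations
(`ExactStructure.gen_iff`). Splicing gives exactness because `Hom(P, -)` is exact on conflations.
Conversely, a deflation from a projective onto each syzygy lifts through the next term, and weak
idempotent completeness lets one cancel: if `g ≫ f` is a deflation, so is `f` (`Deflation.of_comp`).
Iterating this gives `exists_conflations`.

The test with `M` says that the representables `Hom(-, A i)` present `Φ(X)`
(`phi_isRepresentablePresentation_iff`). Every `k`-presentation by finitely generated projectives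
can be traded for one by representables (`IsPresented.exists_isRepresentablePresentation`), because
`M` has finite biproducts.

The tensor product links the two tests. By the co-Yoneda lemma `Hom(-, A i) ⊗ Ψ(P) = Hom(P, A i)`,
so tensoring the presentation with `Ψ(P)` gives the complex `Hom(P, A i)`. Its cokernel is `Φ(X) ⊗
Ψ(P)` and its homology below `k` is Tor. Hence `Hom(P, -)` is exact on the augmented complex if and
only if the composition map is bijective and the Tor groups vanish
(`isHomExactLeft_iff_bijective_and_isZero_torMod`).

In part (2) the exact category is replaced by its opposite. Tor is derived in the first variable,
however, and there the second variable is the one resolved. The necessary balancing is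
`torMod_one_isZero_iff_right` and `torMod_shift_isZero_iff_right`, which rest on flatness of
projective right modules and of representable left modules. `vanishing_iff_exact` then treats both
variables alike. -/

/-! ### Modules on elements -/

section Pointwise

variable {C : Type u} [Category.{v} C] [Preadditive C]

namespace LeftMod

lemma map_hom_apply {F G : LeftMod.{v, u} C} (p : F ⟶ G) {c d : C} (f : c ⟶ d)
    (x : F.obj.obj c) : p.hom.app d (F.obj.map f x) = G.obj.map f (p.hom.app c x) :=
  ConcreteCategory.congr_hom (p.hom.naturality f) x

lemma map_add_apply (F : LeftMod.{v, u} C) {c d : C} (f g : c ⟶ d) (x : F.obj.obj c) :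
    F.obj.map (f + g) x = F.obj.map f x + F.obj.map g x := by
  simp [Functor.map_add]

lemma map_comp_apply (F : LeftMod.{v, u} C) {b c d : C} (f : b ⟶ c) (g : c ⟶ d)
    (x : F.obj.obj b) : F.obj.map (f ≫ g) x = F.obj.map g (F.obj.map f x) := by
  simp

lemma map_id_apply (F : LeftMod.{v, u} C) {c : C} (x : F.obj.obj c) :
    F.obj.map (𝟙 c) x = x := by
  simp

lemma hom_ext_apply {F G : LeftMod.{v, u} C} {p q : F ⟶ G}
    (h : ∀ c (x : F.obj.obj c), p.hom.app c x = q.hom.app c x) : p = q := by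
  ext c x
  exact h c x

lemma ofElement_apply (F : LeftMod.{v, u} C) (c : C) (x : F.obj.obj c) {d : C} (f : c ⟶ d) :
    (ofElement F c x).hom.app d ⟨f⟩ = F.obj.map f x := rfl

lemma ofElement_comp {F G : LeftMod.{v, u} C} (p : F ⟶ G) {c : C} (x : F.obj.obj c) :
    ofElement F c x ≫ p = ofElement G c (p.hom.app c x) :=
  hom_ext_apply fun _ _ => map_hom_apply p _ x

lemma eq_ofElement {F : LeftMod.{v, u} C} {c : C} (p : homFrom (𝟭 C) c ⟶ F) :
    p = ofElement F c (p.hom.app c ⟨𝟙 c⟩) :=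
  hom_ext_apply fun d g => by
    refine Eq.trans (congrArg (p.hom.app d) (ULift.ext _ _ (Category.id_comp _).symm))
      (map_hom_apply p (F := homFrom (𝟭 C) c) (ULift.down g) ⟨𝟙 c⟩)

lemma ofElement_injective {F : LeftMod.{v, u} C} {c : C} {x y : F.obj.obj c}
    (h : ofElement F c x = ofElement F c y) : x = y := by
  have := ConcreteCategory.congr_hom (NatTrans.congr_app (congrArg (fun f => f.hom) h) c) ⟨𝟙 c⟩
  change F.obj.map (𝟙 c) x = F.obj.map (𝟙 c) y at this
  simpa using this

lemma ofElement_zero (F : LeftMod.{v, u} C) (c : C) : ofElement F c 0 = 0 :=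
  hom_ext_apply fun _ g => map_zero (F.obj.map (ULift.down g)).hom

/-- Elements of `F c` are maps from the representable module at `c`, so cancelling `p` against such
maps gives injectivity. -/
lemma mono_iff {F G : LeftMod.{v, u} C} (p : F ⟶ G) :
    Mono p ↔ ∀ c, Function.Injective (p.hom.app c) := by
  refine ⟨fun _ c x y h => ?_, fun h => ⟨fun f g w => hom_ext_apply fun c x => h c ?_⟩⟩
  · apply ofElement_injective
    rw [← cancel_mono p, ofElement_comp, ofElement_comp, h]
  · exact ConcreteCategory.congr_hom (NatTrans.congr_app (congrArg (fun f => f.hom) w) c) x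

lemma comp_eq_zero_iff {F G H : LeftMod.{v, u} C} (f : F ⟶ G) (g : G ⟶ H) :
    f ≫ g = 0 ↔ ∀ c x, g.hom.app c (f.hom.app c x) = 0 :=
  ⟨fun w c x => ConcreteCategory.congr_hom (NatTrans.congr_app (congrArg (fun f => f.hom) w) c) x,
    fun h => hom_ext_apply fun c x => h c x⟩

/-- Exactness of a pair of maps of modules can be checked on elements. -/
lemma exact_iff {F G H : LeftMod.{v, u} C} (f : F ⟶ G) (g : G ⟶ H) :
    (∃ w : f ≫ g = 0, (ShortComplex.mk f g w).Exact) ↔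
      ∀ c, Function.Exact (f.hom.app c) (g.hom.app c) := by
  constructor
  · rintro ⟨w, h⟩ c y
    constructor
    · intro hy
      -- The element `y` becomes a map from a representable, which is projective and therefore lifts
      -- along `f` by exactness.
      have hy' : ofElement G c y ≫ g = 0 := by rw [ofElement_comp, hy, ofElement_zero]
      refine ⟨(h.liftFromProjective (ofElement G c y) hy').hom.app c ⟨𝟙 c⟩, ?_⟩
      apply ofElement_injective
      rw [← ofElement_comp, ← eq_ofElement]
      exact h.liftFromProjective_comp (ofElement G c y) hy'
    · rintro ⟨x, rfl⟩
      exact (comp_eq_zero_iff f g).1 w c x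
  · intro h
    have w : f ≫ g = 0 := (comp_eq_zero_iff f g).2 fun c x => (h c _).2 ⟨x, rfl⟩
    refine ⟨w, ?_⟩
    rw [ShortComplex.exact_iff_epi_kernel_lift, leftMod_epi_iff]
    intro c y
    have hy : g.hom.app c ((kernel.ι g).hom.app c y) = 0 :=
      (comp_eq_zero_iff _ _).1 (kernel.condition g) c y
    obtain ⟨x, hx⟩ := (h c _).1 hy
    refine ⟨x, (mono_iff (kernel.ι g)).1 inferInstance c ?_⟩
    rw [← hx]
    exact ConcreteCategory.congr_hom (NatTrans.congr_app (congrArg (fun f => f.hom)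
      (kernel.lift_ι g f w)) c) x

end LeftMod

end Pointwise

/-! ### The kernel of a composition with a split epimorphism -/

section SplitKernel

variable {A : Type*} [Category* A] [Abelian A]

/-- The kernel of the composition of a split epimorphism with a morphism. -/
noncomputable def kernelSplitCompIso {R Q F : A} (r : R ⟶ Q) (s : Q ⟶ R) (h : s ≫ r = 𝟙 Q)
    (p : Q ⟶ F) : kernel p ⊞ kernel r ≅ kernel (r ≫ p) where
  hom := biprod.desc (kernel.lift _ (kernel.ι p ≫ s) (by simp [reassoc_of% h]))
    (kernel.lift _ (kernel.ι r) (by simp))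
  inv := biprod.lift (kernel.lift _ (kernel.ι (r ≫ p) ≫ r) (by simp))
    (kernel.lift _ (kernel.ι (r ≫ p) ≫ (𝟙 R - r ≫ s))
      (by simp [Preadditive.comp_sub, Preadditive.sub_comp, h]))
  hom_inv_id := by
    ext <;> simp [Preadditive.comp_sub, h, reassoc_of% h]
  inv_hom_id := by
    ext
    simp

end SplitKernel

/-! ### Presentations by representable modules -/

section Presentations

variable {C : Type u} [Category.{v} C] [Preadditive C]

namespace LeftMod

lemma apply_apply {P Q R : LeftMod.{v, u} C} {f : P ⟶ Q} {g : Q ⟶ R} {h : P ⟶ R}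
    (e : f ≫ g = h) {c : C} (x : P.obj.obj c) : g.hom.app c (f.hom.app c x) = h.hom.app c x :=
  ConcreteCategory.congr_hom (NatTrans.congr_app (congrArg (fun f => f.hom) e) c) x

lemma biprod_total_apply {F G : LeftMod.{v, u} C} {c : C} (y : (F ⊞ G).obj.obj c) :
    (biprod.inl : F ⟶ F ⊞ G).hom.app c ((biprod.fst : F ⊞ G ⟶ F).hom.app c y) +
      (biprod.inr : G ⟶ F ⊞ G).hom.app c ((biprod.snd : F ⊞ G ⟶ G).hom.app c y) = y :=
  ConcreteCategory.congr_hom (NatTrans.congr_app (congrArg (fun f => f.hom)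
    (biprod.total : biprod.fst ≫ biprod.inl + biprod.snd ≫ biprod.inr = 𝟙 (F ⊞ G))) c) y

lemma homFrom_fg (c : C) : (homFrom (𝟭 C) c : LeftMod.{v, u} C).FG :=
  ⟨1, fun _ => c, fun _ => ⟨𝟙 c⟩, fun d y => ⟨fun _ => ULift.down y, by
    rw [Fin.sum_univ_one]
    exact ULift.ext _ _ (Category.id_comp _).symm⟩⟩

lemma FG.of_epi {F G : LeftMod.{v, u} C} (h : F.FG) (p : F ⟶ G) [hp : Epi p] : G.FG := by
  obtain ⟨n, c, x, hx⟩ := h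
  refine ⟨n, c, fun i => p.hom.app _ (x i), fun d y => ?_⟩
  obtain ⟨z, rfl⟩ := (leftMod_epi_iff p).1 hp d y
  obtain ⟨f, rfl⟩ := hx d z
  exact ⟨f, by simp⟩

lemma IsPresented.of_iso {k : ℕ∞} {F G : LeftMod.{v, u} C} (e : F ≅ G) (h : F.IsPresented k) :
    G.IsPresented k := by
  obtain ⟨Q, d, ε, hQ, hε, h₀, h₁⟩ := h
  refine ⟨Q, d, ε ≫ e.hom, hQ, epi_comp _ _, fun hk => ?_, h₁⟩
  have h := (exact_iff _ _).1 (h₀ hk)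
  refine (exact_iff _ _).2 fun c y => ((h c) y).symm.trans ?_ |>.symm
  refine ⟨fun hy => ?_, fun hy => ?_⟩
  · change e.hom.hom.app c (ε.hom.app c y) = 0
    rw [hy, map_zero]
  · refine (mono_iff e.hom).1 inferInstance c (Eq.trans hy (map_zero _).symm)

/-- The syzygy of a module with a `k`-presentation. -/
lemma IsPresented.exists_kernel {k : ℕ∞} {F : LeftMod.{v, u} C} (h : F.IsPresented k) :
    ∃ (Q : LeftMod.{v, u} C) (ε : Q ⟶ F), Projective Q ∧ Q.FG ∧ Epi ε ∧
      (0 < k → IsPresented (k - 1) (kernel ε)) := by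
  obtain ⟨Q, d, ε, hQ, hε, h₀, h₁⟩ := h
  refine ⟨Q 0, ε, (hQ 0 (by simp)).1, (hQ 0 (by simp)).2, hε, fun hk => ?_⟩
  obtain ⟨w, hw⟩ := h₀ hk
  -- Subtraction in `ℕ∞` is truncated, with `⊤ - 1 = ⊤`. These two facts turn the degree bounds for
  -- the shifted presentation of the kernel into bounds for `k`.
  have key (i : ℕ) (j : ℕ∞) (h : j < k - i) : j + i < k := lt_tsub_iff_right.1 h
  have key' (i : ℕ) (h : (i : ℕ∞) ≤ k - 1) : ((i + 1 : ℕ) : ℕ∞) ≤ k := by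
    have : (1 : ℕ∞) ≤ k := Order.one_le_iff_pos.2 hk
    rw [← tsub_add_cancel_of_le this, Nat.cast_add, Nat.cast_one]
    gcongr
  refine ⟨fun i => Q (i + 1), fun i => d (i + 1), kernel.lift ε (d 0) w,
    fun i hi => hQ (i + 1) (key' i hi), (ShortComplex.exact_iff_epi_kernel_lift _).1 hw,
    fun h => ?_, fun i h => h₁ (i + 1) (by exact_mod_cast key 1 _ h)⟩
  obtain ⟨w', hw'⟩ := h₁ 0 (by simpa using key 1 0 h)
  refine (exact_iff _ _).2 fun c y => ?_
  refine ((exact_iff _ _).1 ⟨w', hw'⟩ c y).symm.trans ?_ |>.symm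
  have e : ∀ y, (d 0).hom.app c y = (kernel.ι ε).hom.app c ((kernel.lift ε (d 0) w).hom.app c y) :=
    fun y => ConcreteCategory.congr_hom (NatTrans.congr_app (congrArg (fun f => f.hom)
      (kernel.lift_ι ε (d 0) w).symm) c) y
  rw [e]
  exact ⟨fun hy => (mono_iff (kernel.ι ε)).1 inferInstance c (Eq.trans hy (map_zero _).symm),
    fun hy => by rw [hy, map_zero]⟩

variable [HasFiniteBiproducts C]

/-- Finitely many generators at the `c i` combine into one generator at `⨁ c`, so a single
representable suffices. -/
lemma FG.exists_epi {F : LeftMod.{v, u} C} (h : F.FG) :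
    ∃ (c : C) (x : F.obj.obj c), Epi (ofElement F c x) := by
  obtain ⟨n, c, x, hx⟩ := h
  refine ⟨⨁ c, ∑ i, F.obj.map (biproduct.ι c i) (x i), ?_⟩
  rw [leftMod_epi_iff]
  intro d y
  obtain ⟨f, rfl⟩ := hx d y
  refine ⟨⟨biproduct.desc f⟩, ?_⟩
  change F.obj.map (biproduct.desc f) (∑ i, F.obj.map (biproduct.ι c i) (x i)) = _
  simp [← map_comp_apply]

lemma FG.biprod {F G : LeftMod.{v, u} C} (hF : F.FG) (hG : G.FG) :
    LeftMod.FG (F ⊞ G : LeftMod.{v, u} C) := by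
  have := hasBinaryBiproducts_of_finite_biproducts C
  obtain ⟨c, x, hx⟩ := hF.exists_epi
  obtain ⟨c', x', hx'⟩ := hG.exists_epi
  rw [leftMod_epi_iff] at hx hx'
  have e : Epi (ofElement (F ⊞ G : LeftMod.{v, u} C) (c ⊞ c')
      ((biprod.inl : F ⟶ F ⊞ G).hom.app _ (F.obj.map biprod.inl x) +
        (biprod.inr : G ⟶ F ⊞ G).hom.app _ (G.obj.map biprod.inr x'))) := by
    rw [leftMod_epi_iff]
    intro d y
    obtain ⟨⟨f⟩, hf⟩ := hx d ((biprod.fst : F ⊞ G ⟶ F).hom.app d y)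
    obtain ⟨⟨g⟩, hg⟩ := hx' d ((biprod.snd : F ⊞ G ⟶ G).hom.app d y)
    have hf : F.obj.map f x = _ := hf
    have hg : G.obj.map g x' = _ := hg
    refine ⟨⟨biprod.desc f g⟩, ?_⟩
    rw [ofElement_apply, map_add, ← map_hom_apply, ← map_hom_apply, ← map_comp_apply,
      ← map_comp_apply, biprod.inl_desc, biprod.inr_desc, hf, hg]
    exact biprod_total_apply y
  exact FG.of_epi (homFrom_fg (c ⊞ c')) _ (hp := e)

/-- Adding a finitely generated projective summand preserves `k`-presentations. -/
lemma IsPresented.biprod {k : ℕ∞} {F W : LeftMod.{v, u} C} (h : F.IsPresented k)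
    (hW : Projective W) (hW' : W.FG) : IsPresented k (F ⊞ W : LeftMod.{v, u} C) := by
  obtain ⟨Q, d, ε, hQ, hε, h₀, h₁⟩ := h
  -- `W` is added in degree 0 only and maps identically to itself, so the kernel of the augmentation
  -- does not change.
  refine ⟨fun i => Nat.casesOn i (Q 0 ⊞ W) fun i => Q (i + 1),
    fun i => match i with
      | 0 => d 0 ≫ biprod.inl
      | i + 1 => d (i + 1), biprod.map ε (𝟙 W), fun i hi => ?_, inferInstance, fun hk => ?_,
    fun i hi => ?_⟩
  · cases i with
    | zero =>
      have := (hQ 0 hi).1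
      exact ⟨inferInstanceAs (Projective (Q 0 ⊞ W)), (hQ 0 hi).2.biprod hW'⟩
    | succ i => exact hQ (i + 1) hi
  · obtain ⟨w, hw⟩ := h₀ hk
    have w' : (d 0 ≫ biprod.inl) ≫ biprod.map ε (𝟙 W) = 0 := by simp [reassoc_of% w]
    refine (exact_iff _ _).2 fun c y => ⟨fun hy => ?_, ?_⟩
    · obtain ⟨z, hz⟩ := ((exact_iff _ _).1 ⟨w, hw⟩ c ((biprod.fst : Q 0 ⊞ W ⟶ Q 0).hom.app c y)).1
        (by rw [apply_apply (biprod.map_fst ε (𝟙 W)).symm, ← apply_apply rfl, hy, map_zero])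
      refine ⟨z, Eq.trans ?_ (biprod_total_apply y)⟩
      have e : (biprod.snd : Q 0 ⊞ W ⟶ W).hom.app c y = 0 := by
        have := apply_apply (biprod.map_snd ε (𝟙 W)) y
        rw [hy, map_zero, Category.comp_id] at this
        exact this.symm
      rw [e, map_zero, add_zero, ← hz]
      rfl
    · rintro ⟨z, rfl⟩
      exact (comp_eq_zero_iff _ _).1 w' c z
  · cases i with
    | zero =>
      refine (exact_iff _ _).2 fun c y => ((exact_iff _ _).1 (h₁ 0 hi) c y).symm.trans ?_ |>.symm
      exact ⟨fun hy =>
        (congrArg ((biprod.inl : Q 0 ⟶ Q 0 ⊞ W).hom.app c) hy).trans (map_zero _), fun hy =>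
        (mono_iff (biprod.inl : Q 0 ⟶ Q 0 ⊞ W)).1 inferInstance c (Eq.trans hy (map_zero _).symm)⟩
    | succ i => exact h₁ (i + 1) hi

/-- A module with a `k`-presentation is covered by a representable module, whose kernel has a
`(k - 1)`-presentation. -/
lemma IsPresented.exists_kernel_ofElement {k : ℕ∞} {F : LeftMod.{v, u} C} (h : F.IsPresented k) :
    ∃ (c : C) (x : F.obj.obj c), Epi (ofElement F c x) ∧
      (0 < k → IsPresented (k - 1) (kernel (ofElement F c x))) := by
  obtain ⟨Q, ε, hQ, hQ', hε, hk⟩ := h.exists_kernel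
  obtain ⟨c, x, hx⟩ := hQ'.exists_epi
  -- The representable cover of `Q` splits. By `kernelSplitCompIso` the kernel of the composite
  -- cover of `F` is `kernel ε` plus a retract of a representable, that is, plus a finitely
  -- generated projective.
  let s := Projective.factorThru (𝟙 Q) (ofElement Q c x)
  have hs : s ≫ ofElement Q c x = 𝟙 Q := Projective.factorThru_comp _ _
  refine ⟨c, ε.hom.app c x, ?_, fun h => ?_⟩ <;> rw [← ofElement_comp]
  · exact epi_comp _ _
  · let r : Retract (kernel (ofElement Q c x)) (homFrom (𝟭 C) c) :=
      { i := kernel.ι _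
        r := kernel.lift _ (𝟙 _ - ofElement Q c x ≫ s) (by simp [Preadditive.sub_comp, hs])
        retract := by
          rw [← cancel_mono (kernel.ι _)]
          simp [Preadditive.comp_sub] }
    have := IsSplitEpi.mk' r.splitEpi
    exact .of_iso (kernelSplitCompIso _ s hs ε)
      ((hk h).biprod r.projective (FG.of_epi (homFrom_fg c) r.r))

end LeftMod

/-- `F` has the `k`-presentation `⋯ → Hom(c 1, -) → Hom(c 0, -) → F → 0` by representable modules,
given by `δ i : c i ⟶ c (i + 1)` and the element `x` of `F (c 0)`. -/
def LeftMod.IsRepresentablePresentation {C : Type u} [Category.{v} C] [Preadditive C] (k : ℕ∞)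
    (F : LeftMod.{v, u} C) (c : ℕ → C) (δ : ∀ i, c i ⟶ c (i + 1)) (x : F.obj.obj (c 0)) : Prop :=
  (∀ d, Function.Surjective (fun f : c 0 ⟶ d => F.obj.map f x)) ∧
  (0 < k → ∀ d, Function.Exact (fun f : c 1 ⟶ d => δ 0 ≫ f) (fun f : c 0 ⟶ d => F.obj.map f x)) ∧
  ∀ i : ℕ, ((i + 1 : ℕ) : ℕ∞) < k → ∀ d, Function.Exact (fun f : c (i + 2) ⟶ d => δ (i + 1) ≫ f)
    (fun f : c (i + 1) ⟶ d => δ i ≫ f)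

namespace LeftMod

lemma IsRepresentablePresentation.isPresented {k : ℕ∞} {F : LeftMod.{v, u} C} {c : ℕ → C}
    {δ : ∀ i, c i ⟶ c (i + 1)} {x : F.obj.obj (c 0)}
    (h : F.IsRepresentablePresentation k c δ x) : F.IsPresented k := by
  refine ⟨fun i => homFrom (𝟭 C) (c i), fun i => ofElement _ _ ⟨δ i⟩, ofElement F _ x,
    fun i _ => ⟨inferInstance, homFrom_fg _⟩, ?_, fun hk => ?_, fun i hi => ?_⟩
  · rw [leftMod_epi_iff]
    intro d y
    obtain ⟨f, rfl⟩ := h.1 d y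
    exact ⟨⟨f⟩, rfl⟩
  · refine (exact_iff _ _).2 fun d y => (h.2.1 hk d (ULift.down y)).trans ⟨?_, ?_⟩
    · rintro ⟨f, hf⟩
      exact ⟨⟨f⟩, ULift.ext _ _ hf⟩
    · rintro ⟨f, rfl⟩
      exact ⟨ULift.down f, rfl⟩
  · refine (exact_iff _ _).2 fun d y => ?_
    refine Iff.trans ?_ ((h.2.2 i hi d (ULift.down y)).trans ⟨?_, ?_⟩)
    · exact ⟨fun h => congrArg ULift.down h, fun h => ULift.ext _ _ h⟩
    · rintro ⟨f, hf⟩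
      exact ⟨⟨f⟩, ULift.ext _ _ hf⟩
    · rintro ⟨f, rfl⟩
      exact ⟨ULift.down f, rfl⟩

theorem IsPresented.exists_isRepresentablePresentation [HasFiniteBiproducts C] {k : ℕ∞}
    {F : LeftMod.{v, u} C} (h : F.IsPresented k) :
    ∃ (c : ℕ → C) (δ : ∀ i, c i ⟶ c (i + 1)) (x : F.obj.obj (c 0)),
      F.IsRepresentablePresentation k c δ x := by
  -- One stage of the recursion: a module with a presentation length is covered by a representable
  -- and replaced by the kernel, with length one less. At length 0 nothing is known about the
  -- kernel, so the module is kept and `κ` is zero; those terms are never used.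
  have step (s : { s : LeftMod.{v, u} C × ℕ∞ // s.1.IsPresented s.2 }) :
      ∃ (c : C) (x : s.1.1.obj.obj c) (t : { s : LeftMod.{v, u} C × ℕ∞ // s.1.IsPresented s.2 })
        (κ : t.1.1 ⟶ homFrom (𝟭 C) c), t.1.2 = s.1.2 - 1 ∧
        (∀ d, Function.Surjective (fun f : c ⟶ d => s.1.1.obj.map f x)) ∧
        (0 < s.1.2 → Mono κ ∧ ∀ d (f : c ⟶ d), s.1.1.obj.map f x = 0 ↔
          ∃ z, κ.hom.app d z = ⟨f⟩) := by
    obtain ⟨⟨F, j⟩, hF⟩ := s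
    obtain ⟨c, x, hx, hj⟩ := hF.exists_kernel_ofElement
    have hx' (d) : Function.Surjective (fun f : c ⟶ d => F.obj.map f x) := fun y => by
      obtain ⟨⟨f⟩, hf⟩ := (leftMod_epi_iff _).1 hx d y
      exact ⟨f, hf⟩
    by_cases h : 0 < j
    · exact ⟨c, x, ⟨⟨_, _⟩, hj h⟩, kernel.ι _, rfl, hx', fun _ => ⟨inferInstance, fun d f =>
        (exact_iff (kernel.ι (ofElement F c x)) _).1
          ⟨kernel.condition _, ShortComplex.exact_kernel _⟩ d ⟨f⟩⟩⟩
    · obtain rfl : j = 0 := by simpa using h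
      exact ⟨c, x, ⟨⟨F, 0⟩, hF⟩, 0, by simp, hx', fun h => absurd h (by simp)⟩
  choose c x t κ ht hx hκ using step
  let s (i : ℕ) : { s : LeftMod.{v, u} C × ℕ∞ // s.1.IsPresented s.2 } :=
    Nat.rec ⟨⟨F, k⟩, h⟩ (fun _ => t) i
  have hs (i : ℕ) : (s i).1.2 = k - i := by
    induction i with
    | zero => simp [s]
    | succ i ih => rw [Nat.cast_add, Nat.cast_one, ← tsub_tsub, ← ih]; exact ht (s i)
  have hs' {i : ℕ} (h : (i : ℕ∞) < k) : 0 < (s i).1.2 := by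
    rw [hs]
    exact tsub_pos_of_lt h
  -- By Yoneda, the cover of the next kernel followed by its inclusion into the representable at `c
  -- (s i)` is given by a morphism of `C`.
  let δ (i : ℕ) : c (s i) ⟶ c (s (i + 1)) := ULift.down ((κ (s i)).hom.app _ (x (s (i + 1))))
  have hδ (i : ℕ) {d : C} (f : c (s (i + 1)) ⟶ d) :
      (κ (s i)).hom.app d ((s (i + 1)).1.1.obj.map f (x (s (i + 1)))) = ⟨δ i ≫ f⟩ :=
    map_hom_apply (κ (s i)) f _
  have key (i : ℕ) (hi : (i : ℕ∞) < k) {d : C} (f : c (s i) ⟶ d) :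
      (s i).1.1.obj.map f (x (s i)) = 0 ↔ ∃ g : c (s (i + 1)) ⟶ d, δ i ≫ g = f := by
    rw [(hκ (s i) (hs' hi)).2]
    constructor
    · rintro ⟨z, hz⟩
      obtain ⟨g, rfl⟩ := hx (s (i + 1)) d z
      exact ⟨g, congrArg ULift.down ((hδ i g).symm.trans hz)⟩
    · rintro ⟨g, rfl⟩
      exact ⟨_, hδ i g⟩
  refine ⟨fun i => c (s i), δ, x (s 0), hx (s 0), fun hk d f => key 0 hk f, fun i hi d f => ?_⟩
  refine Iff.trans ?_ (key (i + 1) hi f)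
  -- Since `κ (s i)` is a monomorphism, `δ i ≫ f = 0` says that `f` kills the generator of the next
  -- syzygy, which is the left side of `key (i + 1)`.
  have := (hκ (s i) (hs' (lt_of_le_of_lt (by simp) hi))).1
  constructor
  · intro h
    refine (mono_iff (κ (s i))).1 this d ((hδ i f).trans ?_)
    rw [map_zero]
    exact ULift.ext _ _ h
  · intro h
    have := (hδ i f).symm.trans (congrArg _ h)
    rw [map_zero] at this
    exact congrArg ULift.down this

end LeftMod

end Presentations

/-! ### Right exactness, flatness of projectives and the co-Yoneda lemma -/

section TensorMaps

open Opposite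

variable {C : Type u} [Category.{v} C] [Preadditive C]

lemma TensorObj.mem_of_tmul_mem {F : RightMod.{v, u} C} {G : LeftMod.{v, u} C}
    (H : AddSubgroup (TensorObj F G))
    (h : ∀ (c : C) (x : F.obj.obj (op c)) (y : G.obj.obj c), tmul x y ∈ H) (z : TensorObj F G) :
    z ∈ H := by
  have : QuotientAddGroup.mk' H = 0 := tensor_hom_ext fun c x y => by
    simpa using h c x y
  simpa using DFunLike.congr_fun this z

/-- The map of tensor products induced by maps of modules. -/
def tensorMap {F F' : RightMod.{v, u} C} {G G' : LeftMod.{v, u} C} (α : F ⟶ F') (β : G ⟶ G') :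
    TensorObj F G →+ TensorObj F' G' :=
  tensorLift (fun c x y => tmul (α.hom.app _ x) (β.hom.app _ y))
    (fun c x x' y => by simp [tmul_add_left]) (fun c x y y' => by simp [tmul_add_right])
    (fun c d f x y => by
      rw [LeftMod.map_hom_apply, LeftMod.map_hom_apply, tmul_balanced])

@[simp]
lemma tensorMap_tmul {F F' : RightMod.{v, u} C} {G G' : LeftMod.{v, u} C} (α : F ⟶ F')
    (β : G ⟶ G') {c : C} (x : F.obj.obj (op c)) (y : G.obj.obj c) :
    tensorMap α β (tmul x y) = tmul (α.hom.app _ x) (β.hom.app _ y) :=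
  tensorLift_tmul _ _ _ _ _ _

lemma tensorMap_comp {F F' F'' : RightMod.{v, u} C} {G G' G'' : LeftMod.{v, u} C} (α : F ⟶ F')
    (α' : F' ⟶ F'') (β : G ⟶ G') (β' : G' ⟶ G'') (z : TensorObj F G) :
    tensorMap (α ≫ α') (β ≫ β') z = tensorMap α' β' (tensorMap α β z) := by
  suffices tensorMap (α ≫ α') (β ≫ β') = (tensorMap α' β').comp (tensorMap α β) from
    DFunLike.congr_fun this z
  refine tensor_hom_ext fun c x y => ?_
  simp

lemma tensorMap_id (F : RightMod.{v, u} C) (G : LeftMod.{v, u} C) :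
    tensorMap (𝟙 F) (𝟙 G) = AddMonoidHom.id _ := by
  refine tensor_hom_ext fun c x y => ?_
  simp

/-- The functor `F ⊗_C -` from left `C`-modules to abelian groups. -/
def tensorLeft (F : RightMod.{v, u} C) : LeftMod.{v, u} C ⥤ AddCommGrpCat.{max u v} where
  obj G := AddCommGrpCat.of (TensorObj F G)
  map β := AddCommGrpCat.ofHom (tensorMap (𝟙 F) β)
  map_id G := by
    ext : 1
    exact tensorMap_id F G
  map_comp β γ := by
    ext : 1
    refine tensor_hom_ext fun c x y => ?_
    simp

/-- Tensor products are right exact in the first variable. -/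
lemma tensorMap_right_exact_left {F F' F'' : RightMod.{v, u} C} (G : LeftMod.{v, u} C)
    (f : F'' ⟶ F') (g : F' ⟶ F) (hfg : ∀ c, Function.Exact (f.hom.app c) (g.hom.app c))
    (hg : ∀ c, Function.Surjective (g.hom.app c)) :
    Function.Exact (tensorMap f (𝟙 G)) (tensorMap g (𝟙 G)) ∧
      Function.Surjective (tensorMap g (𝟙 G)) := by
  constructor
  · let q := QuotientAddGroup.mk' (tensorMap f (𝟙 G)).range
    have hq {c : C} {a b : F'.obj.obj (op c)} (h : g.hom.app _ a = g.hom.app _ b)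
        (y : G.obj.obj c) : q (tmul a y) = q (tmul b y) := by
      obtain ⟨e, he⟩ := (hfg _ (a - b)).1 (by rw [map_sub, h, sub_self])
      obtain rfl : a = f.hom.app _ e + b := by rw [he, sub_add_cancel]
      rw [tmul_add_left, map_add, add_eq_right]
      exact (QuotientAddGroup.eq_zero_iff _).2 ⟨tmul e y, by simp⟩
    have hs (c) (x) : g.hom.app c (Function.surjInv (hg c) x) = x := Function.surjInv_eq _ _
    let ψ : TensorObj F G →+ _ := tensorLift
      (fun c x y => q (tmul (Function.surjInv (hg (op c)) x) y))
      (fun c x x' y => by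
        rw [← map_add, ← tmul_add_left]
        exact hq (by simp [hs]) y)
      (fun c x y y' => by rw [tmul_add_right, map_add])
      (fun c d k x y => by
        rw [← tmul_balanced]
        exact hq (by rw [hs, LeftMod.map_hom_apply, hs]) y)
    have hψ : ψ.comp (tensorMap g (𝟙 G)) = q := tensor_hom_ext fun c x y => by
      simp only [AddMonoidHom.comp_apply, tensorMap_tmul, ψ, tensorLift_tmul]
      exact hq (hs _ _) y
    intro z
    constructor
    · intro hz
      have : q z = 0 := by rw [← hψ, AddMonoidHom.comp_apply, hz, map_zero]
      exact (QuotientAddGroup.eq_zero_iff _).1 this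
    · rintro ⟨z, rfl⟩
      have : (tensorMap g (𝟙 G)).comp (tensorMap f (𝟙 G)) = 0 := tensor_hom_ext fun c x y => by
        have h : g.hom.app _ (f.hom.app _ x) = 0 := (hfg (op c) _).2 ⟨x, rfl⟩
        have h' : (tmul 0 y : TensorObj F G) = 0 := by
          have := tmul_add_left (F := F) (G := G) (c := c) 0 0 y
          rwa [add_zero, left_eq_add] at this
        simp only [AddMonoidHom.comp_apply, tensorMap_tmul, h]
        exact h'
      exact DFunLike.congr_fun this z
  · refine fun z => TensorObj.mem_of_tmul_mem (tensorMap g (𝟙 G)).range (fun c x y => ?_) z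
    obtain ⟨x, rfl⟩ := hg _ x
    exact ⟨tmul x y, by simp⟩

/-- Tensor products are right exact in the second variable. -/
lemma tensorMap_right_exact_right (F : RightMod.{v, u} C) {G G' G'' : LeftMod.{v, u} C}
    (f : G'' ⟶ G') (g : G' ⟶ G) (hfg : ∀ c, Function.Exact (f.hom.app c) (g.hom.app c))
    (hg : ∀ c, Function.Surjective (g.hom.app c)) :
    Function.Exact (tensorMap (𝟙 F) f) (tensorMap (𝟙 F) g) ∧
      Function.Surjective (tensorMap (𝟙 F) g) := by
  constructor
  · let q := QuotientAddGroup.mk' (tensorMap (𝟙 F) f).range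
    have hq {c : C} {a b : G'.obj.obj c} (h : g.hom.app _ a = g.hom.app _ b)
        (x : F.obj.obj (op c)) : q (tmul x a) = q (tmul x b) := by
      obtain ⟨e, he⟩ := (hfg _ (a - b)).1 (by rw [map_sub, h, sub_self])
      obtain rfl : a = f.hom.app _ e + b := by rw [he, sub_add_cancel]
      rw [tmul_add_right, map_add, add_eq_right]
      exact (QuotientAddGroup.eq_zero_iff _).2 ⟨tmul x e, by simp⟩
    have hs (c) (x) : g.hom.app c (Function.surjInv (hg c) x) = x := Function.surjInv_eq _ _
    let ψ : TensorObj F G →+ _ := tensorLift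
      (fun c x y => q (tmul x (Function.surjInv (hg c) y)))
      (fun c x x' y => by rw [tmul_add_left, map_add])
      (fun c x y y' => by
        rw [← map_add, ← tmul_add_right]
        exact hq (by simp [hs]) x)
      (fun c d k x y => by
        rw [tmul_balanced]
        exact hq (by rw [hs, LeftMod.map_hom_apply, hs]) x)
    have hψ : ψ.comp (tensorMap (𝟙 F) g) = q := tensor_hom_ext fun c x y => by
      simp only [AddMonoidHom.comp_apply, tensorMap_tmul, ψ, tensorLift_tmul]
      exact hq (hs _ _) x
    intro z
    constructor
    · intro hz
      have : q z = 0 := by rw [← hψ, AddMonoidHom.comp_apply, hz, map_zero]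
      exact (QuotientAddGroup.eq_zero_iff _).1 this
    · rintro ⟨z, rfl⟩
      have : (tensorMap (𝟙 F) g).comp (tensorMap (𝟙 F) f) = 0 := tensor_hom_ext fun c x y => by
        have h : g.hom.app _ (f.hom.app _ y) = 0 := (hfg c _).2 ⟨y, rfl⟩
        have h' : (tmul x 0 : TensorObj F G) = 0 := by
          have := tmul_add_right (F := F) (G := G) (c := c) x 0 0
          rwa [add_zero, left_eq_add] at this
        simp only [AddMonoidHom.comp_apply, tensorMap_tmul, h]
        exact h'
      exact DFunLike.congr_fun this z
  · refine fun z => TensorObj.mem_of_tmul_mem (tensorMap (𝟙 F) g).range (fun c x y => ?_) z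
    obtain ⟨y, rfl⟩ := hg _ y
    exact ⟨tmul x y, by simp⟩

/-- The right module `c ↦ Hom(G c, D)`. -/
def homDual (G : LeftMod.{v, u} C) (D : AddCommGrpCat.{max u v}) : RightMod.{v, u} C where
  obj :=
    { obj := fun c => AddCommGrpCat.of (G.obj.obj c.unop →+ D)
      map := fun f => AddCommGrpCat.ofHom
        { toFun := fun φ => φ.comp (G.obj.map f.unop).hom
          map_zero' := rfl
          map_add' := fun _ _ => rfl }
      map_id := fun _ => by ext; simp
      map_comp := fun _ _ => by ext; simp }
  property := ⟨fun {_ _ _ _} => by ext; simp⟩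

/-- An element of `homDual G D` as a homomorphism. -/
def homDualHom {G : LeftMod.{v, u} C} {D : AddCommGrpCat.{max u v}} {c : Cᵒᵖ}
    (φ : (homDual G D).obj.obj c) : G.obj.obj c.unop →+ D := φ

/-- The restriction map `Hom(G', D) ⟶ Hom(G, D)`. -/
def homDualMap {G G' : LeftMod.{v, u} C} (β : G ⟶ G') (D : AddCommGrpCat.{max u v}) :
    homDual G' D ⟶ homDual G D :=
  ObjectProperty.homMk
    { app := fun c => AddCommGrpCat.ofHom
        { toFun := fun φ => φ.comp (β.hom.app c.unop).hom
          map_zero' := rfl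
          map_add' := fun _ _ => rfl }
      naturality := fun c d f => by
        ext φ
        refine AddMonoidHom.ext (M := G.obj.obj d.unop) (N := D) fun y => ?_
        exact congrArg (homDualHom φ) (LeftMod.map_hom_apply β f.unop y).symm }

/-- A map out of a tensor product as a map of right modules. -/
def tensorCurry {F : RightMod.{v, u} C} {G : LeftMod.{v, u} C} {D : AddCommGrpCat.{max u v}}
    (t : TensorObj F G →+ D) : F ⟶ homDual G D :=
  ObjectProperty.homMk
    { app := fun c => AddCommGrpCat.ofHom
        { toFun := fun x => 
            { toFun := fun y => t (tmul (c := c.unop) x y)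
              map_zero' := by
                have := map_add t (tmul (c := c.unop) x 0) (tmul x 0)
                rwa [← tmul_add_right, add_zero, left_eq_add] at this
              map_add' := fun y y' => by rw [tmul_add_right, map_add] }
          map_zero' := by
            ext y
            have := map_add t (tmul (c := c.unop) 0 y) (tmul 0 y)
            rwa [← tmul_add_left, add_zero, left_eq_add] at this
          map_add' := fun x x' => by
            ext y
            exact (congrArg t (tmul_add_left x x' y)).trans (map_add t _ _) }
      naturality := fun c d f => by
        ext x
        refine AddMonoidHom.ext (M := G.obj.obj d.unop) (N := D) fun y => ?_
        exact congrArg t (tmul_balanced f.unop x y) }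

lemma AddCommGrpCat.exists_extension {A B D : AddCommGrpCat.{u}} [Injective D] (i : A ⟶ B)
    (hi : Function.Injective i) (φ : A →+ D) : ∃ ψ : B →+ D, ∀ a, ψ (i a) = φ a := by
  have := (AddCommGrpCat.mono_iff_injective i).2 hi
  exact ⟨(Injective.factorThru (AddCommGrpCat.ofHom φ) i).hom, fun a =>
    ConcreteCategory.congr_hom (Injective.comp_factorThru (AddCommGrpCat.ofHom φ) i) a⟩

/-- By tensor-hom adjunction `t` is a map `P ⟶ homDual G D`. Injectivity of `D` makes `homDual G' D
⟶ homDual G D` an epimorphism, and `P`, being projective, lifts along it. -/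
lemma exists_tensor_extension (P : RightMod.{v, u} C) [Projective P]
    {G G' : LeftMod.{v, u} C} (β : G ⟶ G') (hβ : ∀ c, Function.Injective (β.hom.app c))
    {D : AddCommGrpCat.{max u v}} [Injective D] (t : TensorObj P G →+ D) :
    ∃ s : TensorObj P G' →+ D, s.comp (tensorMap (𝟙 P) β) = t := by
  have : Epi (homDualMap β D) := by
    rw [leftMod_epi_iff]
    intro c φ
    obtain ⟨ψ, hψ⟩ := AddCommGrpCat.exists_extension (β.hom.app c.unop) (hβ _) (homDualHom φ)
    exact ⟨ψ, AddMonoidHom.ext (M := G.obj.obj c.unop) (N := D) hψ⟩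
  let η := Projective.factorThru (tensorCurry t) (homDualMap β D)
  have hη (c : C) (x : P.obj.obj (op c)) (y : G.obj.obj c) :
      homDualHom (η.hom.app _ x) (β.hom.app _ y) = t (tmul x y) :=
    congrArg (fun φ => homDualHom φ y) (LeftMod.apply_apply
      (Projective.factorThru_comp (tensorCurry t) (homDualMap β _)) x)
  refine ⟨tensorLift (fun c x y => homDualHom (η.hom.app _ x) y)
    (fun c x x' y => congrArg (fun φ => homDualHom φ y) (map_add (η.hom.app (op c)).hom x x'))
    (fun c x y y' => map_add (homDualHom (η.hom.app _ x)) y y')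
    (fun c d f x y => congrArg (fun φ => homDualHom φ y) (LeftMod.map_hom_apply η f.op x)),
    tensor_hom_ext fun c x y => ?_⟩
  rw [AddMonoidHom.comp_apply, tensorMap_tmul]
  exact (tensorLift_tmul _ _ _ _ _ _).trans (hη c x y)

/-- Projective right modules are flat. -/
lemma tensorMap_injective_of_projective (P : RightMod.{v, u} C) [Projective P]
    {G G' : LeftMod.{v, u} C} (β : G ⟶ G') (hβ : ∀ c, Function.Injective (β.hom.app c)) :
    Function.Injective (tensorMap (𝟙 P) β) := by
  -- An embedding of `P ⊗ G` into an injective group factors through `P ⊗ G'`, which forces the map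
  -- between them to be injective.
  let A := AddCommGrpCat.of (TensorObj P G)
  obtain ⟨s, hs⟩ := exists_tensor_extension P β hβ (Injective.ι A).hom
  have hj : Function.Injective (Injective.ι A) :=
    (AddCommGrpCat.mono_iff_injective _).1 inferInstance
  exact fun x y h => hj ((DFunLike.congr_fun hs x).symm.trans
    ((congrArg s h).trans (DFunLike.congr_fun hs y)))

/-- The evaluation `F ⊗_C Hom(c, -) → F c`. -/
def tensorHomFromEval (F : RightMod.{v, u} C) (c : C) :
    TensorObj F (homFrom (𝟭 C) c) →+ F.obj.obj (op c) :=
  tensorLift (F := F) (G := homFrom (𝟭 C) c)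
    (fun _ x f => F.obj.map (Quiver.Hom.op (ULift.down f)) x)
    (fun _ _ _ _ => map_add _ _ _)
    (fun _ x f g => LeftMod.map_add_apply F (Quiver.Hom.op (ULift.down f))
      (Quiver.Hom.op (ULift.down g)) x)
    (fun _ _ f x g => (LeftMod.map_comp_apply F f.op (Quiver.Hom.op (ULift.down g)) x).symm)

lemma tensorHomFromEval_tmul (F : RightMod.{v, u} C) (c : C) {d : C} (x : F.obj.obj (op d))
    (f : (homFrom (𝟭 C) c).obj.obj d) :
    tensorHomFromEval F c (tmul x f) = F.obj.map (Quiver.Hom.op (ULift.down f)) x :=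
  tensorLift_tmul _ _ _ _ _ _

/-- Balancedness moves `f` across the tensor sign. So `y ↦ y ⊗ 𝟙 c` undoes the evaluation. -/
lemma tmul_map_id (F : RightMod.{v, u} C) (c : C) {d : C} (x : F.obj.obj (op d))
    (f : (homFrom (𝟭 C) c).obj.obj d) :
    (tmul (F.obj.map (Quiver.Hom.op (ULift.down f)) x) ⟨𝟙 c⟩ : TensorObj F (homFrom (𝟭 C) c)) =
      tmul x f := by
  refine (tmul_balanced (G := homFrom (𝟭 C) c) (ULift.down f) x ⟨𝟙 c⟩).trans ?_
  have : (homFrom (𝟭 C) c).obj.map (ULift.down f) ⟨𝟙 c⟩ = f := ULift.ext _ _ (Category.id_comp _)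
  rw [this]

/-- The co-Yoneda lemma `F ⊗_C Hom(c, -) ≅ F c`. -/
lemma tensorHomFromEval_bijective (F : RightMod.{v, u} C) (c : C) :
    Function.Bijective (tensorHomFromEval F c) := by
  let g : F.obj.obj (op c) →+ TensorObj F (homFrom (𝟭 C) c) :=
    AddMonoidHom.mk' (fun x => tmul x ⟨𝟙 c⟩) fun x x' => tmul_add_left x x' _
  have h : g.comp (tensorHomFromEval F c) = AddMonoidHom.id _ := by
    refine tensor_hom_ext fun d x f => ?_
    rw [AddMonoidHom.comp_apply, tensorHomFromEval_tmul]
    exact tmul_map_id F c x f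
  refine Function.bijective_iff_has_inverse.2 ⟨g, DFunLike.congr_fun h, fun x => ?_⟩
  exact (tensorHomFromEval_tmul F c x ⟨𝟙 c⟩).trans (LeftMod.map_id_apply F x)

/-- The evaluation `Hom(-, c) ⊗_C G → G c`. -/
def homFromTensorEval (G : LeftMod.{v, u} C) (c : Cᵒᵖ) :
    TensorObj (homFrom (𝟭 Cᵒᵖ) c) G →+ G.obj.obj c.unop :=
  tensorLift (F := homFrom (𝟭 Cᵒᵖ) c) (G := G)
    (fun _ f y => G.obj.map (Quiver.Hom.unop (ULift.down f)) y)
    (fun _ f g y => LeftMod.map_add_apply G (Quiver.Hom.unop (ULift.down f))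
      (Quiver.Hom.unop (ULift.down g)) y)
    (fun _ _ _ _ => map_add _ _ _)
    (fun _ _ f x y => LeftMod.map_comp_apply G f (Quiver.Hom.unop (ULift.down x)) y)

lemma homFromTensorEval_tmul (G : LeftMod.{v, u} C) (c : Cᵒᵖ) {d : C}
    (f : (homFrom (𝟭 Cᵒᵖ) c).obj.obj (op d)) (y : G.obj.obj d) :
    homFromTensorEval G c (tmul f y) = G.obj.map (Quiver.Hom.unop (ULift.down f)) y :=
  tensorLift_tmul _ _ _ _ _ _

lemma tmul_id_map (G : LeftMod.{v, u} C) (c : Cᵒᵖ) {d : C}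
    (f : (homFrom (𝟭 Cᵒᵖ) c).obj.obj (op d)) (y : G.obj.obj d) :
    (tmul (F := homFrom (𝟭 Cᵒᵖ) c) (G := G) (c := c.unop) ⟨𝟙 c⟩
      (G.obj.map (Quiver.Hom.unop (ULift.down f)) y)) = tmul f y := by
  refine (tmul_balanced (F := homFrom (𝟭 Cᵒᵖ) c) (Quiver.Hom.unop (ULift.down f))
    ⟨𝟙 c⟩ y).symm.trans ?_
  have : (homFrom (𝟭 Cᵒᵖ) c).obj.map (Quiver.Hom.unop (ULift.down f)).op ⟨𝟙 c⟩ = f :=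
    ULift.ext _ _ (Category.id_comp _)
  rw [this]

/-- The co-Yoneda lemma `Hom(-, c) ⊗_C G ≅ G c`. -/
lemma homFromTensorEval_bijective (G : LeftMod.{v, u} C) (c : Cᵒᵖ) :
    Function.Bijective (homFromTensorEval G c) := by
  let g : G.obj.obj c.unop →+ TensorObj (homFrom (𝟭 Cᵒᵖ) c) G :=
    AddMonoidHom.mk' (fun y => tmul (F := homFrom (𝟭 Cᵒᵖ) c) (c := c.unop) ⟨𝟙 c⟩ y)
      fun y y' => tmul_add_right _ y y'
  have h : g.comp (homFromTensorEval G c) = AddMonoidHom.id _ := by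
    refine tensor_hom_ext fun d f y => ?_
    rw [AddMonoidHom.comp_apply, homFromTensorEval_tmul]
    exact tmul_id_map G c f y
  refine Function.bijective_iff_has_inverse.2 ⟨g, DFunLike.congr_fun h, fun y => ?_⟩
  exact (homFromTensorEval_tmul G c (d := c.unop) ⟨𝟙 c⟩ y).trans (LeftMod.map_id_apply G y)

end TensorMaps

/-! ### Dimension shift for left derived functors -/

section DimensionShift

variable {A : Type*} [Category* A] [Abelian A]

lemma CategoryTheory.ProjectiveResolution.exact_zero {X : A} (R : ProjectiveResolution X) :
    (ShortComplex.mk _ _ R.complex_d_comp_π_f_zero).Exact :=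
  ShortComplex.exact_of_g_is_cokernel _ R.isColimitCokernelCofork

lemma exact_epi_comp {X K P F : A} (e : X ⟶ K) [Epi e] (i : K ⟶ P) (p : P ⟶ F) (w : i ≫ p = 0)
    (h : (ShortComplex.mk i p w).Exact) :
    (ShortComplex.mk (e ≫ i) p (by rw [Category.assoc, w, comp_zero])).Exact := by
  let φ : ShortComplex.mk (e ≫ i) p (by rw [Category.assoc, w, comp_zero]) ⟶
      ShortComplex.mk i p w := { τ₁ := e, τ₂ := 𝟙 _, τ₃ := 𝟙 _ }
  exact (ShortComplex.exact_iff_of_epi_of_isIso_of_mono φ).2 h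

lemma exact_comp_mono {X Y K P : A} (d : X ⟶ Y) (e : Y ⟶ K) (i : K ⟶ P) [Mono i] (w : d ≫ e = 0)
    (h : (ShortComplex.mk d e w).Exact) :
    (ShortComplex.mk d (e ≫ i) (by rw [← Category.assoc, w, zero_comp])).Exact := by
  let φ : ShortComplex.mk d e w ⟶
      ShortComplex.mk d (e ≫ i) (by rw [← Category.assoc, w, zero_comp]) :=
    { τ₁ := 𝟙 _, τ₂ := 𝟙 _, τ₃ := i }
  exact (ShortComplex.exact_iff_of_epi_of_isIso_of_mono φ).1 h

lemma comp_comp_eq_zero {X Y K P : A} {d : X ⟶ Y} {e : Y ⟶ K} (w : d ≫ e = 0) (i : K ⟶ P) :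
    d ≫ e ≫ i = 0 := by
  rw [← Category.assoc, w, zero_comp]

/-- The projective resolution of `F` obtained from a short exact sequence `0 → K → P → F → 0` with
`P` projective and a projective resolution of `K`. -/
noncomputable def CategoryTheory.ProjectiveResolution.splice {K P F : A}
    (R : ProjectiveResolution K) (i : K ⟶ P) (p : P ⟶ F) (w : i ≫ p = 0)
    (h : (ShortComplex.mk i p w).ShortExact) [Projective P] : ProjectiveResolution F where
  complex := ChainComplex.augment R.complex (R.π.f 0 ≫ i)
    (comp_comp_eq_zero R.complex_d_comp_π_f_zero i)
  projective n := by
    cases n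
    · assumption
    · exact R.projective _
  π := (ChainComplex.toSingle₀Equiv _ _).symm
    ⟨p, (Category.assoc (R.π.f 0) i p).trans ((congrArg (R.π.f 0 ≫ ·) w).trans comp_zero)⟩
  -- Degree 0 is exactness at `P` together with `p` being epi; degree 1 holds because `i` is mono;
  -- higher degrees are those of `R`, shifted by one.
  quasiIso := ⟨fun n => by
    cases n
    · rw [ChainComplex.quasiIsoAt₀_iff, ShortComplex.quasiIso_iff_of_zeros']
      · dsimp
        have := h.epi_g
        refine (ShortComplex.exact_and_epi_g_iff_of_iso ?_).2
          ⟨exact_epi_comp (R.π.f 0) i p w h.exact, h.epi_g⟩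
        exact ShortComplex.isoMk (Iso.refl _) (Iso.refl _) (Iso.refl _)
          ((Category.id_comp (R.π.f 0 ≫ i)).trans (Category.comp_id (R.π.f 0 ≫ i)).symm)
          ((Category.id_comp p).trans (Eq.trans (ChainComplex.toSingle₀Equiv_symm_apply_f_zero
            (C := R.complex.augment (R.π.f 0 ≫ i) _) p _).symm (Category.comp_id _).symm))
      all_goals rfl
    · rename_i n
      rw [quasiIsoAt_iff_exactAt']
      · rw [HomologicalComplex.exactAt_iff' _ (n + 2) (n + 1) n (by simp) (by simp)]
        cases n
        · have := h.mono_f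
          exact exact_comp_mono _ _ i _ R.exact_zero
        · exact R.exact_succ _
      · apply ChainComplex.exactAt_succ_single_obj⟩

variable [EnoughProjectives A]

lemma isZero_leftDerived_succ_iff {B : Type*} [Category* B] [Abelian B] (T : A ⥤ B) [T.Additive]
    {X : A} (R : ProjectiveResolution X) (n : ℕ) :
    IsZero ((T.leftDerived (n + 1)).obj X) ↔
      (ShortComplex.mk (T.map (R.complex.d (n + 2) (n + 1))) (T.map (R.complex.d (n + 1) n))
        (by rw [← T.map_comp, R.complex.d_comp_d, T.map_zero])).Exact := by
  rw [(R.isoLeftDerivedObj T (n + 1)).isZero_iff]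
  refine (HomologicalComplex.exactAt_iff_isZero_homology _ _).symm.trans ?_
  exact HomologicalComplex.exactAt_iff' _ (n + 2) (n + 1) n (by simp) (by simp)

/-- The spliced resolution of `F` has the differentials of `R` one degree higher, so both sides are
exactness of the same complex. -/
lemma isZero_leftDerived_shift_iff {B : Type*} [Category* B] [Abelian B] (T : A ⥤ B) [T.Additive]
    {K P F : A} (i : K ⟶ P) (p : P ⟶ F) (w : i ≫ p = 0) (h : (ShortComplex.mk i p w).ShortExact)
    [Projective P] (n : ℕ) :
    IsZero ((T.leftDerived (n + 2)).obj F) ↔ IsZero ((T.leftDerived (n + 1)).obj K) := by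
  let R := projectiveResolution K
  rw [isZero_leftDerived_succ_iff T R, isZero_leftDerived_succ_iff T (R.splice i p w h)]
  rfl

/-- Here `e` is a cokernel of `d`, so the kernel of `i ∘ e` exceeds the image of `d` exactly by the
kernel of `i`. -/
lemma exact_comp_iff_injective {X Y K P : Type*} [AddGroup X] [AddGroup Y] [AddGroup K] [AddGroup P]
    {d : X →+ Y} {e : Y →+ K} (h : Function.Exact d e) (he : Function.Surjective e) (i : K →+ P) :
    Function.Exact d (fun y => i (e y)) ↔ Function.Injective i := by
  rw [injective_iff_map_eq_zero]
  constructor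
  · intro H y hy
    obtain ⟨y, rfl⟩ := he y
    obtain ⟨x, rfl⟩ := (H y).1 hy
    exact h.apply_apply_eq_zero x
  · intro H y
    exact ⟨fun hy => (h y).1 (H _ hy), fun hy => by
      simp only [(h y).2 hy, map_zero]⟩

/-- Right exactness presents `T K` as the cokernel of `T R₁ → T R₀`. The first homology of the
spliced complex is thus the kernel of `T i`. -/
lemma isZero_leftDerived_one_iff (T : A ⥤ AddCommGrpCat.{u}) [T.Additive]
    (hT : ∀ {X Y Z : A} (f : X ⟶ Y) (g : Y ⟶ Z) (w : f ≫ g = 0), (ShortComplex.mk f g w).Exact →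
      Epi g → Function.Exact (T.map f) (T.map g) ∧ Function.Surjective (T.map g))
    {K P F : A} (i : K ⟶ P) (p : P ⟶ F) (w : i ≫ p = 0) (h : (ShortComplex.mk i p w).ShortExact)
    [Projective P] :
    IsZero ((T.leftDerived 1).obj F) ↔ Function.Injective (T.map i) := by
  let R := projectiveResolution K
  obtain ⟨h₁, h₂⟩ := hT _ _ _ R.exact_zero inferInstance
  rw [isZero_leftDerived_succ_iff T (R.splice i p w h), ShortComplex.ab_exact_iff_function_exact]
  refine Iff.trans ?_ (exact_comp_iff_injective (d := (T.map (R.complex.d 1 0)).hom)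
    (e := (T.map (R.π.f 0)).hom) h₁ h₂ (T.map i).hom)
  refine forall_congr' fun y => iff_congr (iff_of_eq (congrArg (· = 0) ?_)) Iff.rfl
  exact ConcreteCategory.congr_hom (T.map_comp (R.π.f 0) i) y

end DimensionShift

/-! ### Tor through the second variable -/

section TorBalance

/-- A piece of the snake lemma: the kernel of `hF` is controlled by the kernel of `aG`. It serves
twice below, on a diagram and on its transpose. -/
lemma injective_of_injective_of_exact {LK LQ LG PK PQ PG FK FQ : Type*} [AddGroup LK]
    [AddGroup LQ] [AddGroup LG] [AddGroup PK] [AddGroup PQ] [AddGroup PG] [AddGroup FK]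
    [AddGroup FQ] {aK : LK →+ PK} {bK : PK →+ FK} {aQ : LQ →+ PQ} {bQ : PQ →+ FQ} {aG : LG →+ PG}
    {hL : LK →+ LQ} {gL : LQ →+ LG} {hP : PK →+ PQ} {gP : PQ →+ PG} {hF : FK →+ FQ}
    (c₁ : ∀ x, hP (aK x) = aQ (hL x)) (c₂ : ∀ x, hF (bK x) = bQ (hP x))
    (c₃ : ∀ x, gP (aQ x) = aG (gL x)) (h₁ : Function.Surjective bK) (h₂ : ∀ x, bK (aK x) = 0)
    (h₃ : Function.Exact aQ bQ) (h₄ : Function.Injective hP) (h₅ : ∀ x, gP (hP x) = 0)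
    (h₆ : Function.Exact hL gL) (h : Function.Injective aG) : Function.Injective hF := by
  rw [injective_iff_map_eq_zero] at h ⊢
  intro x hx
  obtain ⟨y, rfl⟩ := h₁ x
  obtain ⟨z, hz⟩ := (h₃ _).1 ((c₂ y).symm.trans hx)
  obtain ⟨t, rfl⟩ := (h₆ z).1 (h _ (by rw [← c₃, hz, h₅]))
  rw [← h₄ ((c₁ t).trans hz), h₂]

open Opposite

variable {C : Type u} [Category.{v} C] [Preadditive C]

/-- Short exactness of a pair of maps of modules, on elements. -/
structure LeftMod.IsShortExact {K P F : LeftMod.{v, u} C} (i : K ⟶ P) (p : P ⟶ F) : Prop where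
  injective : ∀ c, Function.Injective (i.hom.app c)
  exact : ∀ c, Function.Exact (i.hom.app c) (p.hom.app c)
  surjective : ∀ c, Function.Surjective (p.hom.app c)

namespace LeftMod

lemma IsShortExact.shortExact {K P F : LeftMod.{v, u} C} {i : K ⟶ P} {p : P ⟶ F}
    (h : IsShortExact i p) : ∃ w : i ≫ p = 0, (ShortComplex.mk i p w).ShortExact := by
  obtain ⟨w, h'⟩ := (exact_iff i p).2 h.exact
  exact ⟨w, { exact := h', mono_f := (mono_iff i).2 h.injective,
              epi_g := (leftMod_epi_iff p).2 h.surjective }⟩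

lemma isShortExact_kernel {P F : LeftMod.{v, u} C} (p : P ⟶ F)
    (h : ∀ c, Function.Surjective (p.hom.app c)) : IsShortExact (kernel.ι p) p where
  injective := (mono_iff _).1 inferInstance
  exact := (exact_iff _ _).1 ⟨kernel.condition p, ShortComplex.exact_kernel p⟩
  surjective := h

end LeftMod

lemma torMod_one_isZero_iff {K P F : RightMod.{v, u} C} (G : LeftMod.{v, u} C) {i : K ⟶ P}
    {p : P ⟶ F} (h : LeftMod.IsShortExact i p) [Projective P] :
    IsZero (TorMod 1 F G) ↔ Function.Injective (tensorMap i (𝟙 G)) := by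
  obtain ⟨w, h⟩ := h.shortExact
  refine isZero_leftDerived_one_iff (tensorRight G) (fun f g w h hg => ?_) i p w h
  exact tensorMap_right_exact_left G f g ((LeftMod.exact_iff f g).1 ⟨w, h⟩)
    ((leftMod_epi_iff g).1 hg)

lemma torMod_shift_isZero_iff {K P F : RightMod.{v, u} C} (G : LeftMod.{v, u} C) {i : K ⟶ P}
    {p : P ⟶ F} (h : LeftMod.IsShortExact i p) [Projective P] (n : ℕ) :
    IsZero (TorMod (n + 2) F G) ↔ IsZero (TorMod (n + 1) K G) := by
  obtain ⟨w, h⟩ := h.shortExact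
  exact isZero_leftDerived_shift_iff (tensorRight G) i p w h n

lemma tensorMap_square {F F' : RightMod.{v, u} C} {G G' : LeftMod.{v, u} C} (α : F ⟶ F')
    (β : G ⟶ G') (z : TensorObj F G) :
    tensorMap (𝟙 F') β (tensorMap α (𝟙 G) z) = tensorMap α (𝟙 G') (tensorMap (𝟙 F) β z) := by
  rw [← tensorMap_comp, ← tensorMap_comp]
  simp

variable {K Q G : LeftMod.{v, u} C} {i : K ⟶ Q} {p : Q ⟶ G}

/-- Tensor `0 → L → P → F → 0` with `0 → K → Q → G → 0`. As `P` and `Q` are flat, the snake chase in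
both directions makes injectivity of `L ⊗ G → P ⊗ G` equivalent to that of `F ⊗ K → F ⊗ Q`. -/
lemma torMod_one_isZero_iff_right (F : RightMod.{v, u} C) (h : LeftMod.IsShortExact i p)
    (hQ : ∀ {L P : RightMod.{v, u} C} (α : L ⟶ P), (∀ c, Function.Injective (α.hom.app c)) →
      Function.Injective (tensorMap α (𝟙 Q))) :
    IsZero (TorMod 1 F G) ↔ Function.Injective (tensorMap (𝟙 F) i) := by
  have hF := LeftMod.isShortExact_kernel (Projective.π F) ((leftMod_epi_iff _).1 inferInstance)
  obtain ⟨h₁, h₂⟩ := tensorMap_right_exact_right (kernel (Projective.π F)) i p h.exact h.surjective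
  obtain ⟨h₃, h₄⟩ := tensorMap_right_exact_right (Projective.over F) i p h.exact h.surjective
  obtain ⟨h₅, h₆⟩ := tensorMap_right_exact_left K _ _ hF.exact hF.surjective
  obtain ⟨h₇, h₈⟩ := tensorMap_right_exact_left Q _ _ hF.exact hF.surjective
  have h₉ := tensorMap_injective_of_projective (Projective.over F) i h.injective
  rw [torMod_one_isZero_iff G hF]
  constructor
  · exact injective_of_injective_of_exact (tensorMap_square _ _) (tensorMap_square _ _)
      (tensorMap_square _ _) h₆ h₅.apply_apply_eq_zero h₇ h₉ h₃.apply_apply_eq_zero h₁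
  · exact injective_of_injective_of_exact (fun x => (tensorMap_square _ _ x).symm)
      (fun x => (tensorMap_square _ _ x).symm)
      (fun x => (tensorMap_square _ _ x).symm) h₂ h₁.apply_apply_eq_zero h₃ (hQ _ hF.injective)
      h₇.apply_apply_eq_zero h₅

/-- For `n = 0`, with `L` the kernel of `P → F`, the two sides say that `L ⊗ K → L ⊗ Q` and `L ⊗ K →
P ⊗ K` are injective. By flatness of `Q` and `P` either one means that `L ⊗ K → P ⊗ Q` is injective.
For larger `n` one shifts in `F`. -/
lemma torMod_shift_isZero_iff_right (F : RightMod.{v, u} C) (h : LeftMod.IsShortExact i p)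
    (hQ : ∀ {L P : RightMod.{v, u} C} (α : L ⟶ P), (∀ c, Function.Injective (α.hom.app c)) →
      Function.Injective (tensorMap α (𝟙 Q))) (n : ℕ) :
    IsZero (TorMod (n + 2) F G) ↔ IsZero (TorMod (n + 1) F K) := by
  induction n generalizing F with
  | zero =>
    have hF := LeftMod.isShortExact_kernel (Projective.π F) ((leftMod_epi_iff _).1 inferInstance)
    have h' := tensorMap_injective_of_projective (Projective.over F) i h.injective
    rw [torMod_shift_isZero_iff G hF, torMod_one_isZero_iff K hF,
      torMod_one_isZero_iff_right _ h hQ, ← h'.of_comp_iff, ← (hQ _ hF.injective).of_comp_iff]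
    refine iff_of_eq (congrArg Function.Injective (funext fun x => ?_))
    exact (tensorMap_square _ _ _).symm
  | succ n ih =>
    have hF := LeftMod.isShortExact_kernel (Projective.π F) ((leftMod_epi_iff _).1 inferInstance)
    rw [torMod_shift_isZero_iff G hF, torMod_shift_isZero_iff K hF, ih]

end TorBalance

/-! ### Vanishing of derived functors on representable resolutions -/

section RepresentableResolution

open Opposite

/-- Exactness in the middle only needs surjectivity on the left and injectivity on the right. All
passages between `Hom`, `ULift`, opposites and tensor products with representables go through this.
-/
lemma Function.Exact.iff_of_bijective_ladder {X Y Z X' Y' Z' : Type*} [AddGroup Z] [AddGroup Z']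
    {f : X → Y} {g : Y → Z} {f' : X' → Y'} {g' : Y' → Z'} (a : X → X') (b : Y → Y') (c : Z →+ Z')
    (ha : Function.Surjective a) (hb : Function.Bijective b) (hc : Function.Injective c)
    (h₁ : ∀ x, b (f x) = f' (a x)) (h₂ : ∀ y, c (g y) = g' (b y)) :
    Function.Exact f g ↔ Function.Exact f' g' := by
  rw [Function.Exact, Function.Exact, hb.2.forall]
  refine forall_congr' fun y => iff_congr ?_ ⟨?_, ?_⟩
  · rw [← h₂, map_eq_zero_iff c hc]
  · rintro ⟨x, rfl⟩
    exact ⟨a x, (h₁ x).symm⟩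
  · rintro ⟨x, hx⟩
    obtain ⟨x, rfl⟩ := ha x
    exact ⟨x, hb.1 ((h₁ x).trans hx)⟩

variable {C : Type u} [Category.{v} C] [Preadditive C]

namespace LeftMod

lemma exact_kernel_lift {P Q R S : LeftMod.{v, u} C} {f : P ⟶ Q} {g : Q ⟶ R} {h : R ⟶ S}
    (hfg : ∀ c, Function.Exact (f.hom.app c) (g.hom.app c)) (w : g ≫ h = 0) (c : C) :
    Function.Exact (f.hom.app c) ((kernel.lift h g w).hom.app c) := by
  intro y
  refine Iff.trans ?_ (hfg c y)
  have e : g.hom.app c y = (kernel.ι h).hom.app c ((kernel.lift h g w).hom.app c y) :=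
    (apply_apply (kernel.lift_ι h g w) y).symm
  rw [e]
  exact (map_eq_zero_iff _ ((mono_iff (kernel.ι h)).1 inferInstance c)).symm

lemma surjective_kernel_lift {Q R S : LeftMod.{v, u} C} {g : Q ⟶ R} {h : R ⟶ S}
    (hgh : ∀ c, Function.Exact (g.hom.app c) (h.hom.app c)) (w : g ≫ h = 0) (c : C) :
    Function.Surjective ((kernel.lift h g w).hom.app c) := by
  obtain ⟨w, hw⟩ := (exact_iff g h).2 hgh
  exact (leftMod_epi_iff _).1 ((ShortComplex.exact_iff_epi_kernel_lift _).1 hw) c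

/-- Let `Z (n + 1)`, `n ≥ 0`, be a predicate satisfying the dimension shift rules for the vanishing
of the left derived functors of the right exact functor `T`. It can be checked on a resolution
by representable modules. -/
theorem vanishing_iff_exact (T : LeftMod.{v, u} C ⥤ AddCommGrpCat.{max u v})
    (Z : ℕ → LeftMod.{v, u} C → Prop)
    (hT : ∀ {X Y W : LeftMod.{v, u} C} (f : X ⟶ Y) (g : Y ⟶ W),
      (∀ c, Function.Exact (f.hom.app c) (g.hom.app c)) →
      (∀ c, Function.Surjective (g.hom.app c)) →
      Function.Exact (T.map f) (T.map g) ∧ Function.Surjective (T.map g))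
    (h₁ : ∀ (c : C) {K G : LeftMod.{v, u} C} (i : K ⟶ homFrom (𝟭 C) c) (p : homFrom (𝟭 C) c ⟶ G),
      IsShortExact i p → (Z 1 G ↔ Function.Injective (T.map i)))
    (h₂ : ∀ (c : C) {K G : LeftMod.{v, u} C} (i : K ⟶ homFrom (𝟭 C) c) (p : homFrom (𝟭 C) c ⟶ G),
      IsShortExact i p → ∀ n, (Z (n + 2) G ↔ Z (n + 1) K))
    (n : ℕ) {G : LeftMod.{v, u} C} (c : ℕ → C)
    (d : ∀ i, homFrom (𝟭 C) (c (i + 1)) ⟶ homFrom (𝟭 C) (c i)) (ε : homFrom (𝟭 C) (c 0) ⟶ G)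
    (hε : ∀ a, Function.Surjective (ε.hom.app a))
    (hd : ∀ a, Function.Exact ((d 0).hom.app a) (ε.hom.app a))
    (hd' : ∀ i ≤ n, ∀ a, Function.Exact ((d (i + 1)).hom.app a) ((d i).hom.app a)) :
    Z (n + 1) G ↔ Function.Exact (T.map (d (n + 1))) (T.map (d n)) := by
  have w : d 0 ≫ ε = 0 := (comp_eq_zero_iff _ _).2 fun a x => (hd a _).2 ⟨x, rfl⟩
  have hs := surjective_kernel_lift hd w
  have he := exact_kernel_lift (hd' 0 (Nat.zero_le n)) w
  induction n generalizing G c with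
  | zero =>
    obtain ⟨h₃, h₄⟩ := hT _ _ he hs
    -- The map `d 1` presents the kernel of `ε`, and `T` preserves this cokernel, so injectivity of
    -- `T` on the inclusion becomes exactness of the complex.
    rw [h₁ (c 0) _ _ (isShortExact_kernel ε hε)]
    refine (exact_comp_iff_injective (d := (T.map (d 1)).hom) (e := (T.map (kernel.lift ε _ w)).hom)
      h₃ h₄ (T.map (kernel.ι ε)).hom).symm.trans ?_
    refine forall_congr' fun y => iff_congr (iff_of_eq (congrArg (· = 0) ?_)) Iff.rfl
    exact (ConcreteCategory.congr_hom (T.map_comp (kernel.lift ε _ w) (kernel.ι ε)) y).symm.trans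
      (congrArg (fun f => T.map f y) (kernel.lift_ι _ _ _))
  | succ n ih =>
    rw [h₂ (c 0) _ _ (isShortExact_kernel ε hε)]
    -- Without its degree 0 term the resolution resolves the kernel of `ε`.
    have w' : d 1 ≫ kernel.lift ε _ w = 0 :=
      (comp_eq_zero_iff _ _).2 fun a x => (he a _).2 ⟨x, rfl⟩
    exact ih (fun i => c (i + 1)) (fun i => d (i + 1)) (kernel.lift ε _ w) hs he
      (fun i hi => hd' (i + 1) (by omega)) w' (surjective_kernel_lift he w')
      (exact_kernel_lift (hd' 1 (by omega)) w')

namespace IsRepresentablePresentation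

variable {k : ℕ∞} {G : LeftMod.{v, u} C} {c : ℕ → C} {δ : ∀ i, c i ⟶ c (i + 1)}
  {x : G.obj.obj (c 0)}

lemma surjective (h : G.IsRepresentablePresentation k c δ x) (a : C) :
    Function.Surjective ((ofElement G (c 0) x).hom.app a) := fun y => by
  obtain ⟨f, hf⟩ := h.1 a y
  exact ⟨⟨f⟩, hf⟩

lemma exact_zero (h : G.IsRepresentablePresentation k c δ x) (hk : 0 < k) (a : C) :
    Function.Exact ((ofElement (homFrom (𝟭 C) (c 0)) (c 1) ⟨δ 0⟩).hom.app a)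
      ((ofElement G (c 0) x).hom.app a) := by
  refine (Function.Exact.iff_of_bijective_ladder ULift.up ULift.up (AddMonoidHom.id _)
    ULift.up_surjective ULift.up_bijective Function.injective_id ?_ ?_).1 (h.2.1 hk a)
  · intro x; rfl
  · intro x; rfl

lemma exact_succ (h : G.IsRepresentablePresentation k c δ x) (i : ℕ) (hk : ((i + 1 : ℕ) : ℕ∞) < k)
    (a : C) :
    Function.Exact ((ofElement (homFrom (𝟭 C) (c (i + 1))) (c (i + 2)) ⟨δ (i + 1)⟩).hom.app a)
      ((ofElement (homFrom (𝟭 C) (c i)) (c (i + 1)) ⟨δ i⟩).hom.app a) := by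
  refine (Function.Exact.iff_of_bijective_ladder ULift.up ULift.up
    (AddEquiv.ulift.symm : (c i ⟶ a) ≃+ ULift.{max u v} (c i ⟶ a)).toAddMonoidHom
    ULift.up_surjective ULift.up_bijective ULift.up_injective ?_ ?_).1 (h.2.2 i hk a)
  · intro x; rfl
  · intro x; rfl

end IsRepresentablePresentation

end LeftMod

end RepresentableResolution

/-! ### Tor computed from representable presentations -/

section TorRepresentable

open Opposite

variable {C : Type u} [Category.{v} C] [Preadditive C]

lemma tensorHomFromEval_naturality (F : RightMod.{v, u} C) {c d : C} (f : c ⟶ d)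
    (z : TensorObj F (homFrom (𝟭 C) d)) :
    tensorHomFromEval F c (tensorMap (𝟙 F) (ofElement (homFrom (𝟭 C) c) d ⟨f⟩) z) =
      F.obj.map f.op (tensorHomFromEval F d z) := by
  suffices (tensorHomFromEval F c).comp (tensorMap (𝟙 F) (ofElement (homFrom (𝟭 C) c) d ⟨f⟩)) =
    (F.obj.map f.op).hom.comp (tensorHomFromEval F d) from DFunLike.congr_fun this z
  refine tensor_hom_ext fun e x g => ?_
  rw [AddMonoidHom.comp_apply, AddMonoidHom.comp_apply, tensorMap_tmul, tensorHomFromEval_tmul,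
    tensorHomFromEval_tmul]
  exact LeftMod.map_comp_apply F (Quiver.Hom.op (ULift.down g)) f.op x

/-- With the naturality of the evaluation, this identifies the tensored presentation with `F (c 1) →
F (c 0) → F ⊗ G`. -/
lemma tensorMap_ofElement_right (F : RightMod.{v, u} C) {G : LeftMod.{v, u} C} {c : C}
    (x : G.obj.obj c) (z : TensorObj F (homFrom (𝟭 C) c)) :
    tensorMap (𝟙 F) (ofElement G c x) z = tmul (tensorHomFromEval F c z) x := by
  let φ : F.obj.obj (op c) →+ TensorObj F G :=
    AddMonoidHom.mk' (fun y => tmul y x) fun y y' => tmul_add_left y y' x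
  suffices tensorMap (𝟙 F) (ofElement G c x) = φ.comp (tensorHomFromEval F c) from
    DFunLike.congr_fun this z
  refine tensor_hom_ext fun e y g => ?_
  rw [AddMonoidHom.comp_apply, tensorMap_tmul, tensorHomFromEval_tmul]
  exact (tmul_balanced (ULift.down g) y x).symm

lemma homFromTensorEval_naturality (G : LeftMod.{v, u} C) {c d : Cᵒᵖ} (f : c ⟶ d)
    (z : TensorObj (homFrom (𝟭 Cᵒᵖ) d) G) :
    homFromTensorEval G c (tensorMap (ofElement (homFrom (𝟭 Cᵒᵖ) c) d ⟨f⟩) (𝟙 G) z) =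
      G.obj.map f.unop (homFromTensorEval G d z) := by
  suffices (homFromTensorEval G c).comp (tensorMap (ofElement (homFrom (𝟭 Cᵒᵖ) c) d ⟨f⟩) (𝟙 G)) =
    (G.obj.map f.unop).hom.comp (homFromTensorEval G d) from DFunLike.congr_fun this z
  refine tensor_hom_ext fun e g y => ?_
  rw [AddMonoidHom.comp_apply, AddMonoidHom.comp_apply, tensorMap_tmul, homFromTensorEval_tmul,
    homFromTensorEval_tmul]
  exact LeftMod.map_comp_apply G (Quiver.Hom.unop (ULift.down g)) f.unop y

lemma tensorMap_ofElement_left {F : RightMod.{v, u} C} (G : LeftMod.{v, u} C) {c : Cᵒᵖ}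
    (x : F.obj.obj c) (z : TensorObj (homFrom (𝟭 Cᵒᵖ) c) G) :
    tensorMap (ofElement F c x) (𝟙 G) z = tmul (c := c.unop) x (homFromTensorEval G c z) := by
  let φ : G.obj.obj c.unop →+ TensorObj F G :=
    AddMonoidHom.mk' (fun y => tmul (c := c.unop) x y) fun y y' => tmul_add_right x y y'
  suffices tensorMap (ofElement F c x) (𝟙 G) = φ.comp (homFromTensorEval G c) from
    DFunLike.congr_fun this z
  refine tensor_hom_ext fun e g y => ?_
  rw [AddMonoidHom.comp_apply, tensorMap_tmul, homFromTensorEval_tmul]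
  exact tmul_balanced (Quiver.Hom.unop (ULift.down g)) x y

/-- Representable left modules are flat. -/
lemma tensorMap_homFrom_injective (c : C) {F F' : RightMod.{v, u} C} (α : F ⟶ F')
    (hα : ∀ c, Function.Injective (α.hom.app c)) :
    Function.Injective (tensorMap α (𝟙 (homFrom (𝟭 C) c))) := by
  refine Function.Injective.of_comp (f := tensorHomFromEval F' c) ?_
  have : tensorHomFromEval F' c ∘ tensorMap α (𝟙 (homFrom (𝟭 C) c)) =
      α.hom.app (op c) ∘ tensorHomFromEval F c := by
    suffices (tensorHomFromEval F' c).comp (tensorMap α (𝟙 (homFrom (𝟭 C) c))) =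
      (α.hom.app (op c)).hom.comp (tensorHomFromEval F c) from
      funext fun z => DFunLike.congr_fun this z
    refine tensor_hom_ext fun e x g => ?_
    rw [AddMonoidHom.comp_apply, AddMonoidHom.comp_apply, tensorMap_tmul, tensorHomFromEval_tmul,
      tensorHomFromEval_tmul]
    exact (LeftMod.map_hom_apply α _ x).symm
  rw [this]
  exact (hα _).comp (tensorHomFromEval_bijective F c).1

namespace LeftMod.IsRepresentablePresentation

section Right

variable (F : RightMod.{v, u} C) {G : LeftMod.{v, u} C} {k : ℕ∞} {c : ℕ → C}
  {δ : ∀ i, c i ⟶ c (i + 1)} {x : G.obj.obj (c 0)}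

lemma tmul_surjective_right (h : G.IsRepresentablePresentation k c δ x) :
    Function.Surjective (fun y => (tmul y x : TensorObj F G)) := by
  intro z
  refine TensorObj.mem_of_tmul_mem (AddMonoidHom.mk' (fun y => (tmul y x : TensorObj F G))
    fun y y' => tmul_add_left y y' x).range (fun a y y' => ?_) z
  obtain ⟨f, rfl⟩ := h.1 a y'
  exact ⟨F.obj.map f.op y, tmul_balanced f y x⟩

/-- The tensor product with a presented left module is a cokernel. -/
lemma exact_tmul_right (h : G.IsRepresentablePresentation k c δ x) (hk : 0 < k) :
    Function.Exact (F.obj.map (δ 0).op) (fun y => (tmul y x : TensorObj F G)) := by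
  refine (Function.Exact.iff_of_bijective_ladder (tensorHomFromEval F (c 1))
    (tensorHomFromEval F (c 0)) (AddMonoidHom.id _) (tensorHomFromEval_bijective _ _).2
    (tensorHomFromEval_bijective _ _) Function.injective_id
    (tensorHomFromEval_naturality F (δ 0)) (tensorMap_ofElement_right F x)).1
    (tensorMap_right_exact_right F _ _ (h.exact_zero hk) h.surjective).1

theorem torMod_isZero_iff_right (h : G.IsRepresentablePresentation k c δ x) (i : ℕ)
    (hi : ((i + 1 : ℕ) : ℕ∞) < k) :
    IsZero (TorMod (i + 1) F G) ↔
      Function.Exact (F.obj.map (δ (i + 1)).op) (F.obj.map (δ i).op) := by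
  rw [vanishing_iff_exact (tensorLeft F) (fun i G => IsZero (TorMod i F G))
    (fun f g hfg hg => tensorMap_right_exact_right F f g hfg hg)
    (fun c _ _ i p hp => torMod_one_isZero_iff_right F hp (tensorMap_homFrom_injective c))
    (fun c _ _ i p hp => torMod_shift_isZero_iff_right F hp (tensorMap_homFrom_injective c))
    i c (fun i => ofElement _ _ ⟨δ i⟩) (ofElement G _ x) h.surjective
    (h.exact_zero (lt_of_le_of_lt (by simp) hi))
    (fun j hj => h.exact_succ j (lt_of_le_of_lt (by gcongr) hi))]
  exact Function.Exact.iff_of_bijective_ladder (tensorHomFromEval F _) (tensorHomFromEval F _)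
    (tensorHomFromEval F _) (tensorHomFromEval_bijective _ _).2 (tensorHomFromEval_bijective _ _)
    (tensorHomFromEval_bijective _ _).1 (tensorHomFromEval_naturality F _)
    (tensorHomFromEval_naturality F _)

end Right

section Left

variable {F : RightMod.{v, u} C} (G : LeftMod.{v, u} C) {k : ℕ∞} {c : ℕ → Cᵒᵖ}
  {δ : ∀ i, c i ⟶ c (i + 1)} {x : F.obj.obj (c 0)}

lemma tmul_surjective_left (h : LeftMod.IsRepresentablePresentation k F c δ x) :
    Function.Surjective (fun y => (tmul (c := (c 0).unop) x y : TensorObj F G)) := by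
  intro z
  refine TensorObj.mem_of_tmul_mem (AddMonoidHom.mk'
    (fun y => (tmul (c := (c 0).unop) x y : TensorObj F G))
    fun y y' => tmul_add_right x y y').range (fun a y y' => ?_) z
  obtain ⟨f, rfl⟩ := h.1 (op a) y
  exact ⟨G.obj.map f.unop y', (tmul_balanced f.unop x y').symm⟩

/-- The tensor product with a presented right module is a cokernel. -/
lemma exact_tmul_left (h : LeftMod.IsRepresentablePresentation k F c δ x) (hk : 0 < k) :
    Function.Exact (G.obj.map (δ 0).unop)
      (fun y => (tmul (c := (c 0).unop) x y : TensorObj F G)) := by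
  refine (Function.Exact.iff_of_bijective_ladder (homFromTensorEval G (c 1))
    (homFromTensorEval G (c 0)) (AddMonoidHom.id _) (homFromTensorEval_bijective _ _).2
    (homFromTensorEval_bijective _ _) Function.injective_id
    (homFromTensorEval_naturality G (δ 0)) (tensorMap_ofElement_left G x)).1
    (tensorMap_right_exact_left G _ _ (h.exact_zero hk) h.surjective).1

theorem torMod_isZero_iff_left (h : LeftMod.IsRepresentablePresentation k F c δ x) (i : ℕ)
    (hi : ((i + 1 : ℕ) : ℕ∞) < k) :
    IsZero (TorMod (i + 1) F G) ↔
      Function.Exact (G.obj.map (δ (i + 1)).unop) (G.obj.map (δ i).unop) := by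
  rw [vanishing_iff_exact (tensorRight G) (fun i F => IsZero (TorMod i F G))
    (fun f g hfg hg => tensorMap_right_exact_left G f g hfg hg)
    (fun c _ _ i p hp => torMod_one_isZero_iff G hp)
    (fun c _ _ i p hp => torMod_shift_isZero_iff G hp)
    i c (fun i => ofElement _ _ ⟨δ i⟩) (ofElement F _ x) h.surjective
    (h.exact_zero (lt_of_le_of_lt (by simp) hi))
    (fun j hj => h.exact_succ j (lt_of_le_of_lt (by gcongr) hi))]
  exact Function.Exact.iff_of_bijective_ladder (homFromTensorEval G _) (homFromTensorEval G _)
    (homFromTensorEval G _) (homFromTensorEval_bijective _ _).2 (homFromTensorEval_bijective _ _)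
    (homFromTensorEval_bijective _ _).1 (homFromTensorEval_naturality G _)
    (homFromTensorEval_naturality G _)

end Left

end LeftMod.IsRepresentablePresentation

end TorRepresentable

/-! ### Opposite exact structures and cancellation of deflations -/

section ExactCategories

variable {E : Type u} [Category.{v} E] [Preadditive E]

namespace ExactStructure

variable (S : ExactStructure E)

/-- The opposite exact structure. -/
def op : ExactStructure Eᵒᵖ where
  Conflation T := S.Conflation T.unop
  of_iso {T T'} e h := by
    let e' : T.unop ≅ T'.unop := ShortComplex.isoMk (ShortComplex.π₃.mapIso e).unop.symm
      (ShortComplex.π₂.mapIso e).unop.symm (ShortComplex.π₁.mapIso e).unop.symm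
      (congrArg Quiver.Hom.unop e.inv.comm₂₃.symm) (congrArg Quiver.Hom.unop e.inv.comm₁₂.symm)
    exact S.of_iso e' h
  isKernel {T} h := by
    obtain ⟨h⟩ := S.isCokernel h
    exact ⟨CokernelCofork.IsColimit.ofπOp _ _ h⟩
  isCokernel {T} h := by
    obtain ⟨h⟩ := S.isKernel h
    exact ⟨KernelFork.IsLimit.ofιOp _ _ h⟩
  id_inflation A := by
    obtain ⟨K, i, w, h⟩ := S.id_deflation A.unop
    exact ⟨.op K, i.op, Quiver.Hom.unop_inj w, h⟩
  id_deflation A := by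
    obtain ⟨K, i, w, h⟩ := S.id_inflation A.unop
    exact ⟨.op K, i.op, Quiver.Hom.unop_inj w, h⟩
  comp_inflation := by
    rintro A B C i j ⟨D, p, w, h⟩ ⟨D', p', w', h'⟩
    obtain ⟨K, q, w'', h''⟩ := S.comp_deflation j.unop i.unop
      ⟨_, p'.unop, Quiver.Hom.op_inj w', h'⟩ ⟨_, p.unop, Quiver.Hom.op_inj w, h⟩
    exact ⟨.op K, q.op, Quiver.Hom.unop_inj w'', h''⟩
  comp_deflation := by
    rintro A B C i j ⟨D, p, w, h⟩ ⟨D', p', w', h'⟩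
    obtain ⟨K, q, w'', h''⟩ := S.comp_inflation j.unop i.unop
      ⟨_, p'.unop, Quiver.Hom.op_inj w', h'⟩ ⟨_, p.unop, Quiver.Hom.op_inj w, h⟩
    exact ⟨.op K, q.op, Quiver.Hom.unop_inj w'', h''⟩
  pushout_inflation := by
    rintro A B A' i f ⟨D, p, w, h⟩
    obtain ⟨B', p', f', hp, K, j, w', h'⟩ := S.pullback_deflation i.unop f.unop
      ⟨_, p.unop, Quiver.Hom.op_inj w, h⟩
    exact ⟨.op B', p'.op, f'.op, hp.op.flip, .op K, j.op, Quiver.Hom.unop_inj w', h'⟩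
  pullback_deflation := by
    rintro A B A' i f ⟨D, p, w, h⟩
    obtain ⟨B', p', f', hp, K, j, w', h'⟩ := S.pushout_inflation i.unop f.unop
      ⟨_, p.unop, Quiver.Hom.op_inj w, h⟩
    exact ⟨.op B', p'.op, f'.op, hp.op.flip, .op K, j.op, Quiver.Hom.unop_inj w', h'⟩

variable {S}

lemma op_deflation_iff {A B : Eᵒᵖ} (p : A ⟶ B) : S.op.Deflation p ↔ S.Inflation p.unop := by
  constructor
  · rintro ⟨K, i, w, h⟩
    exact ⟨K.unop, i.unop, Quiver.Hom.op_inj w, h⟩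
  · rintro ⟨K, i, w, h⟩
    exact ⟨.op K, i.op, Quiver.Hom.unop_inj w, h⟩

lemma Deflation.epi {A B : E} {p : A ⟶ B} (h : S.Deflation p) : Epi p := by
  obtain ⟨K, i, w, h⟩ := h
  obtain ⟨h⟩ := S.isCokernel h
  exact epi_of_isColimit_cofork h

lemma Inflation.mono {A B : E} {i : A ⟶ B} (h : S.Inflation i) : Mono i := by
  obtain ⟨K, i, w, h⟩ := h
  obtain ⟨h⟩ := S.isKernel h
  exact mono_of_isLimit_fork h

/-- Maps that vanish after composition with the deflation of a conflation factor through its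
inflation. -/
lemma Conflation.exists_lift {T : ShortComplex E} (h : S.Conflation T) {W : E} (f : W ⟶ T.X₂)
    (hf : f ≫ T.g = 0) : ∃ g : W ⟶ T.X₁, g ≫ T.f = f := by
  obtain ⟨h⟩ := S.isKernel h
  exact ⟨_, (KernelFork.IsLimit.lift' h f hf).2⟩

lemma Conflation.exists_desc {T : ShortComplex E} (h : S.Conflation T) {W : E} (f : T.X₂ ⟶ W)
    (hf : T.f ≫ f = 0) : ∃ g : T.X₃ ⟶ W, T.g ≫ g = f := by
  obtain ⟨h⟩ := S.isCokernel h
  exact ⟨_, (CokernelCofork.IsColimit.desc' h f hf).2⟩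

lemma Deflation.of_arrow_iso {A B A' B' : E} {p : A ⟶ B} (h : S.Deflation p) {p' : A' ⟶ B'}
    (a : A ≅ A') (b : B ≅ B') (w : p ≫ b.hom = a.hom ≫ p') : S.Deflation p' := by
  obtain ⟨K, i, w', h⟩ := h
  have w'' : (i ≫ a.hom) ≫ p' = 0 := by rw [Category.assoc, ← w, reassoc_of% w', zero_comp]
  let e : ShortComplex.mk i p w' ≅ ShortComplex.mk (i ≫ a.hom) p' w'' :=
    ShortComplex.isoMk (Iso.refl _) a b (by simp) w.symm
  exact ⟨K, i ≫ a.hom, w'', S.of_iso e h⟩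

lemma Inflation.of_arrow_iso {A B A' B' : E} {i : A ⟶ B} (h : S.Inflation i) {i' : A' ⟶ B'}
    (a : A ≅ A') (b : B ≅ B') (w : i ≫ b.hom = a.hom ≫ i') : S.Inflation i' := by
  obtain ⟨K, p, w', h⟩ := h
  have w'' : i' ≫ b.inv ≫ p = 0 := by
    rw [← cancel_epi a.hom, ← reassoc_of% w, b.hom_inv_id_assoc, w', comp_zero]
  let e : ShortComplex.mk i p w' ≅ ShortComplex.mk i' (b.inv ≫ p) w'' :=
    ShortComplex.isoMk a b (Iso.refl _) w.symm (by simp)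
  exact ⟨K, b.inv ≫ p, w'', S.of_iso e h⟩

lemma Deflation.of_isPullback {B C B' C' : E} {p : B ⟶ C} (h : S.Deflation p) {f : C' ⟶ C}
    {f' : B' ⟶ B} {p' : B' ⟶ C'} (hp : IsPullback f' p' p f) : S.Deflation p' := by
  obtain ⟨B'', p'', f'', hp', h'⟩ := S.pullback_deflation p f h
  exact Deflation.of_arrow_iso (p := p'') h' (hp'.isoIsPullback _ _ hp) (Iso.refl _) (by simp)

lemma Inflation.of_isPushout {A B A' B' : E} {i : A ⟶ B} (h : S.Inflation i) {f : A ⟶ A'}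
    {i' : A' ⟶ B'} {f' : B ⟶ B'} (hp : IsPushout i f f' i') : S.Inflation i' := by
  obtain ⟨B'', i'', f'', hp', h'⟩ := S.pushout_inflation i f h
  exact Inflation.of_arrow_iso (i := i'') h' (Iso.refl _) (hp'.isoIsPushout _ _ hp) (by simp)

lemma Deflation.comp {A B C : E} {p : A ⟶ B} {q : B ⟶ C} (hp : S.Deflation p)
    (hq : S.Deflation q) : S.Deflation (p ≫ q) := S.comp_deflation p q hp hq

lemma deflation_of_iso {A B : E} (e : A ≅ B) : S.Deflation e.hom :=
  Deflation.of_arrow_iso (S.id_deflation A) (Iso.refl _) e (by simp)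

variable [HasBinaryBiproducts E]

lemma deflation_biprod_snd (A B : E) : S.Deflation (biprod.snd : A ⊞ B ⟶ B) := by
  -- The cokernel `p` of the identity is zero, and the projection is its pullback along a zero map.
  obtain ⟨C, p, w, h⟩ := S.id_inflation A
  have hp : p = 0 := by simpa using w
  refine Deflation.of_isPullback (p := p) (f := 0) (f' := biprod.fst) ⟨A, 𝟙 A, w, h⟩
    ⟨⟨by simp [hp]⟩, ⟨PullbackCone.IsLimit.mk _ (fun s => biprod.lift s.fst s.snd) (by simp)
      (by simp) fun s m h₁ h₂ => ?_⟩⟩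
  ext <;> simp [h₁, h₂]

lemma Deflation.biprod_map_id {A C : E} {h : A ⟶ C} (hh : S.Deflation h) (B : E) :
    S.Deflation (biprod.map (𝟙 B) h) := by
  refine hh.of_isPullback (f := biprod.snd) (f' := biprod.snd) ⟨⟨by simp⟩,
    ⟨PullbackCone.IsLimit.mk _ (fun s => biprod.lift (s.snd ≫ biprod.fst) s.fst) (by simp)
      (fun s => ?_) fun s m h₁ h₂ => ?_⟩⟩
  · ext <;> simp [s.condition]
  · ext
    · simp [← h₂]
    · simp [h₁]

lemma Deflation.biprod_desc {A B C : E} {h : A ⟶ C} (hh : S.Deflation h) (f : B ⟶ C) :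
    S.Deflation (biprod.desc f h) := by
  -- A shear automorphism: it sends the graph-free summand `B` to the graph of `f`.
  let e : B ⊞ C ≅ B ⊞ C :=
    { hom := biprod.desc (biprod.lift (𝟙 _) f) biprod.inr
      inv := biprod.desc (biprod.lift (𝟙 _) (-f)) biprod.inr
      hom_inv_id := by ext <;> simp
      inv_hom_id := by ext <;> simp }
  have : biprod.desc f h = biprod.map (𝟙 B) h ≫ e.hom ≫ biprod.snd := by
    ext <;> simp [e]
  rw [this]
  exact (hh.biprod_map_id B).comp ((deflation_of_iso e).comp (deflation_biprod_snd _ _))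

lemma Deflation.fst_comp {A B C : E} {g : A ⟶ B} {f : B ⟶ C} (h : S.Deflation (g ≫ f)) :
    S.Deflation ((biprod.fst : B ⊞ A ⟶ B) ≫ f) := by
  -- The shear by `-g` cancels the contribution of `g ≫ f` on the summand `A`.
  let e : B ⊞ A ≅ B ⊞ A :=
    { hom := biprod.desc biprod.inl (biprod.lift (-g) (𝟙 _))
      inv := biprod.desc biprod.inl (biprod.lift g (𝟙 _))
      hom_inv_id := by ext <;> simp
      inv_hom_id := by ext <;> simp }
  have : (biprod.fst : B ⊞ A ⟶ B) ≫ f = e.hom ≫ biprod.desc f (g ≫ f) := by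
    ext <;> simp [e]
  rw [this]
  exact (deflation_of_iso e).comp (h.biprod_desc f)

/-- In a weakly idempotent complete exact category, `f` is a deflation if `g ≫ f` is. -/
theorem Deflation.of_comp (hE : WeaklyIdempotentComplete E) {A B C : E} {g : A ⟶ B} {f : B ⟶ C}
    (h : S.Deflation (g ≫ f)) : S.Deflation f := by
  have hd := h.fst_comp
  have := hd.epi
  have : Epi f := epi_of_epi (biprod.fst : B ⊞ A ⟶ B) f
  obtain ⟨N, j, w, hj⟩ := hd
  have : Mono j := Inflation.mono ⟨_, _, w, hj⟩
  -- `A` is killed by `fst ≫ f`, hence lies in its kernel `N` and is a retract of it. Weak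
  -- idempotent completeness supplies the complement, which is the expected kernel of `f`.
  obtain ⟨s, hs⟩ := Conflation.exists_lift hj (biprod.inr : A ⟶ B ⊞ A) (by simp)
  dsimp at s hs
  have hs' : s ≫ j ≫ biprod.snd = 𝟙 A := by rw [reassoc_of% hs, biprod.inr_snd]
  have := hE (j ≫ biprod.snd) s hs'
  let ι := kernel.ι (j ≫ biprod.snd)
  have hι : ι ≫ j ≫ biprod.snd = 0 := kernel.condition _
  let ρ : N ⟶ kernel (j ≫ biprod.snd) := kernel.lift _ (𝟙 N - j ≫ biprod.snd ≫ s)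
    (by simp [Preadditive.sub_comp, hs'])
  have hρ : ρ ≫ ι = 𝟙 N - j ≫ biprod.snd ≫ s := kernel.lift_ι _ _ _
  have hιρ : ι ≫ ρ = 𝟙 _ := by
    rw [← cancel_mono ι, Category.assoc, hρ, Preadditive.comp_sub, reassoc_of% hι]
    simp
  have hsρ : s ≫ ρ = 0 := by
    rw [← cancel_mono ι, Category.assoc, hρ, Preadditive.comp_sub, reassoc_of% hs']
    simp
  have hρκ : ρ ≫ ι ≫ j ≫ biprod.fst = j ≫ biprod.fst := by
    rw [reassoc_of% hρ, Preadditive.sub_comp]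
    simp [reassoc_of% hs]
  -- Dividing `N` and `B ⊞ A` by the common summand `A` is a pushout of `j` along `ρ`, so the
  -- complement includes into `B` by an inflation.
  have hκ : S.Inflation (ι ≫ j ≫ biprod.fst) := by
    refine Inflation.of_isPushout (i := j) ⟨_, _, w, hj⟩ (f := ρ) (f' := biprod.fst)
      ⟨⟨hρκ.symm⟩, ⟨PushoutCocone.IsColimit.mk _ (fun t => biprod.inl ≫ t.inl) (fun t => ?_)
        (fun t => ?_) fun t m h₁ _ => ?_⟩⟩
    · have h : biprod.inr ≫ t.inl = 0 := by
        rw [← hs, Category.assoc, t.condition, reassoc_of% hsρ, zero_comp]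
      ext <;> simp [h]
    · have h : biprod.inr ≫ t.inl = 0 := by
        rw [← hs, Category.assoc, t.condition, reassoc_of% hsρ, zero_comp]
      have h' : biprod.fst ≫ biprod.inl ≫ t.inl = t.inl := by
        ext <;> simp [h]
      simp only [Category.assoc, h']
      rw [t.condition, reassoc_of% hιρ]
    · simp [← h₁]
  -- The cokernel `q` of that inflation agrees with `f` up to the isomorphism given by `r` and `t`.
  obtain ⟨D, q, wq, hq⟩ := hκ
  have := Deflation.epi ⟨_, _, wq, hq⟩
  obtain ⟨t, ht⟩ := Conflation.exists_desc hj (biprod.fst ≫ q) (by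
    dsimp
    rw [← Category.assoc, ← hρκ, Category.assoc, wq, comp_zero])
  obtain ⟨r, hr⟩ := Conflation.exists_desc hq f (by simp [w])
  dsimp at t ht r hr
  have ht : f ≫ t = q := by
    rw [← cancel_epi (biprod.fst : B ⊞ A ⟶ B), ← ht, Category.assoc]
  exact Deflation.of_arrow_iso ⟨_, _, wq, hq⟩ (Iso.refl _)
    { hom := r
      inv := t
      hom_inv_id := by rw [← cancel_epi q, reassoc_of% hr, ht, Category.comp_id]
      inv_hom_id := by rw [← cancel_epi f, reassoc_of% ht, hr, Category.comp_id] }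
    (by simpa using hr)

end ExactStructure

/-- In `E` the kernel of the retraction `s.unop` is a complement of the image of `r.unop`, and the
projection `ρ` onto it is a cokernel of `r.unop`. -/
lemma WeaklyIdempotentComplete.op (hE : WeaklyIdempotentComplete E) :
    WeaklyIdempotentComplete Eᵒᵖ := by
  intro A B r s h
  have hsr : r.unop ≫ s.unop = 𝟙 _ := Quiver.Hom.op_inj h
  have := hE s.unop r.unop hsr
  let ρ : A.unop ⟶ kernel s.unop := kernel.lift _ (𝟙 _ - s.unop ≫ r.unop)
    (by simp [Preadditive.sub_comp, hsr])
  have hρ : ρ ≫ kernel.ι s.unop = 𝟙 _ - s.unop ≫ r.unop := kernel.lift_ι _ _ _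
  have hιρ : kernel.ι s.unop ≫ ρ = 𝟙 _ := by
    rw [← cancel_mono (kernel.ι s.unop), Category.assoc, hρ, Preadditive.comp_sub]
    simp
  have hrρ : r.unop ≫ ρ = 0 := by
    rw [← cancel_mono (kernel.ι s.unop), Category.assoc, hρ, Preadditive.comp_sub,
      reassoc_of% hsr]
    simp
  have w : ρ.op ≫ r = 0 := Quiver.Hom.unop_inj hrρ
  refine HasLimit.mk ⟨KernelFork.ofι ρ.op w, KernelFork.IsLimit.ofι _ _
    (fun x _ => x ≫ (kernel.ι s.unop).op) (fun x hx => ?_) fun x hx m hm => ?_⟩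
  · rw [Category.assoc, ← op_comp, hρ, op_sub, Preadditive.comp_sub]
    simp [reassoc_of% hx]
  · rw [← hm, Category.assoc, ← op_comp, hιρ]
    simp

end ExactCategories

/-! ### Conflation sequences and Hom-exactness -/

section Sequences

variable {E : Type u} [Category.{v} E] [Preadditive E]

/-- Exactness of `Hom(N, A k) → ⋯ → Hom(N, A 0) → Hom(N, X) → 0`. -/
def IsHomExactLeft (k : ℕ∞) {X : E} {A : ℕ → E} (a : A 0 ⟶ X) (d : ∀ i, A (i + 1) ⟶ A i)
    (N : E) : Prop :=
  Function.Surjective (fun f : N ⟶ A 0 => f ≫ a) ∧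
  (0 < k → Function.Exact (fun f : N ⟶ A 1 => f ≫ d 0) (fun f : N ⟶ A 0 => f ≫ a)) ∧
  ∀ i : ℕ, ((i + 1 : ℕ) : ℕ∞) < k →
    Function.Exact (fun f : N ⟶ A (i + 2) => f ≫ d (i + 1)) (fun f : N ⟶ A (i + 1) => f ≫ d i)

/-- Exactness of `Hom(A k, N) → ⋯ → Hom(A 0, N) → Hom(X, N) → 0`. -/
def IsHomExactRight (k : ℕ∞) {X : E} {A : ℕ → E} (a : X ⟶ A 0) (d : ∀ i, A i ⟶ A (i + 1))
    (N : E) : Prop :=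
  Function.Surjective (fun f : A 0 ⟶ N => a ≫ f) ∧
  (0 < k → Function.Exact (fun f : A 1 ⟶ N => d 0 ≫ f) (fun f : A 0 ⟶ N => a ≫ f)) ∧
  ∀ i : ℕ, ((i + 1 : ℕ) : ℕ∞) < k →
    Function.Exact (fun f : A (i + 2) ⟶ N => d (i + 1) ≫ f) (fun f : A (i + 1) ⟶ N => d i ≫ f)

variable {k : ℕ∞}

lemma IsHomExactLeft.congr {X : E} {A : ℕ → E} {a a' : A 0 ⟶ X} {d d' : ∀ i, A (i + 1) ⟶ A i}
    {N : E} (h : IsHomExactLeft k a d N) (ha : a' = a)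
    (hd : ∀ i : ℕ, ((i + 1 : ℕ) : ℕ∞) ≤ k → d' i = d i) : IsHomExactLeft k a' d' N := by
  refine ⟨ha ▸ h.1, fun hk => ?_, fun i hi => ?_⟩
  · rw [ha, hd 0 (by simpa using Order.one_le_iff_pos.2 hk)]
    exact h.2.1 hk
  · rw [hd i hi.le, hd (i + 1) (by
      have := Order.add_one_le_of_lt hi
      exact_mod_cast this)]
    exact h.2.2 i hi

/-- Only degrees up to `k` need to be isomorphic; beyond them `u` and `v` are arbitrary, which
allows irrelevant terms to be exchanged. -/
lemma IsHomExactLeft.of_iso {X : E} {A A' : ℕ → E} {a : A 0 ⟶ X} {d : ∀ i, A (i + 1) ⟶ A i}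
    {N : E} (h : IsHomExactLeft k a d N) (u : ∀ i, A' i ⟶ A i) (v : ∀ i, A i ⟶ A' i)
    (huv : ∀ i : ℕ, (i : ℕ∞) ≤ k → u i ≫ v i = 𝟙 _ ∧ v i ≫ u i = 𝟙 _) :
    IsHomExactLeft k (u 0 ≫ a) (fun i => u (i + 1) ≫ d i ≫ v i) N := by
  have hb (i : ℕ) (hi : (i : ℕ∞) ≤ k) : Function.Bijective (fun f : N ⟶ A i => f ≫ v i) :=
    Function.bijective_iff_has_inverse.2 ⟨fun f => f ≫ u i, fun f => by simp [(huv i hi).2],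
      fun f => by simp [(huv i hi).1]⟩
  refine ⟨fun f => ?_, fun hk => ?_, fun i hi => ?_⟩
  · obtain ⟨g, rfl⟩ := h.1 f
    exact ⟨g ≫ v 0, by simp [reassoc_of% (huv 0 (by simp)).2]⟩
  · have h1 : ((1 : ℕ) : ℕ∞) ≤ k := by simpa using Order.one_le_iff_pos.2 hk
    refine (Function.Exact.iff_of_bijective_ladder _ _ (AddMonoidHom.id _) (hb 1 h1).2
      (hb 0 (by simp)) Function.injective_id (fun f => ?_) (fun f => ?_)).1 (h.2.1 hk)
    · simp [reassoc_of% (huv 1 h1).2]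
    · simp [reassoc_of% (huv 0 (by simp)).2]
  · have h2 : ((i + 2 : ℕ) : ℕ∞) ≤ k := by exact_mod_cast Order.add_one_le_of_lt hi
    have h0 : (i : ℕ∞) ≤ k := le_trans (by simp) hi.le
    refine (Function.Exact.iff_of_bijective_ladder _ _ (Preadditive.rightComp N (v i)) (hb _ h2).2
      (hb _ hi.le) (hb i h0).1 (fun f => ?_) (fun f => ?_)).1 (h.2.2 i hi)
    · simp [reassoc_of% (huv _ h2).2]
    · simp [reassoc_of% (huv _ hi.le).2, Preadditive.rightComp]

lemma isHomExactLeft_op_iff {X : E} {A : ℕ → E} {a : X ⟶ A 0}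
    {d : ∀ i, A i ⟶ A (i + 1)} {N : E} :
    IsHomExactLeft k (X := Opposite.op X) (A := fun i => Opposite.op (A i)) a.op
      (fun i => (d i).op) (Opposite.op N) ↔
      IsHomExactRight k a d N := by
  have e (i : ℕ) : Function.Bijective (Quiver.Hom.unop : (Opposite.op N ⟶ .op (A i)) → (A i ⟶ N)) :=
    Quiver.Hom.opEquiv.symm.bijective
  refine and_congr ?_ (and_congr (forall_congr' fun hk => ?_)
    (forall_congr' fun i => forall_congr' fun hi => ?_))
  · constructor
    · intro h f
      obtain ⟨g, hg⟩ := h f.op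
      exact ⟨g.unop, congrArg Quiver.Hom.unop hg⟩
    · intro h f
      obtain ⟨g, hg⟩ := h f.unop
      exact ⟨g.op, congrArg Quiver.Hom.op hg⟩
  · exact Function.Exact.iff_of_bijective_ladder _ _ (unopHom (Opposite.op N) (Opposite.op X))
      (e 1).2 (e 0) Quiver.Hom.opEquiv.symm.injective (fun _ => rfl) (fun _ => rfl)
  · exact Function.Exact.iff_of_bijective_ladder _ _ (unopHom (Opposite.op N) (Opposite.op (A i)))
      (e _).2 (e _) Quiver.Hom.opEquiv.symm.injective (fun _ => rfl) (fun _ => rfl)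

namespace ExactStructure

variable {S : ExactStructure E}

lemma LeftSequence.isHomExactLeft {X : E} (T : S.LeftSequence k X) {P : E}
    (hP : S.IsProjective P) : IsHomExactLeft k T.aug T.d P := by
  have key (i : ℕ) (hi : ((i + 1 : ℕ) : ℕ∞) ≤ k) (f : P ⟶ T.A i) :
      f ≫ T.π i = 0 ↔ ∃ g, g ≫ T.d i = f := by
    constructor
    · intro hf
      obtain ⟨g, rfl⟩ := Conflation.exists_lift (T.conflation i (le_trans (by simp) hi)) f hf
      obtain ⟨g, rfl⟩ := hP (T.π (i + 1)) ⟨_, _, _, T.conflation (i + 1) hi⟩ g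
      exact ⟨g, by simp [LeftSequence.d]⟩
    · rintro ⟨g, rfl⟩
      simp [LeftSequence.d, T.w]
  refine ⟨fun f => ?_, fun hk f => ?_, fun i hi f => ?_⟩
  · obtain ⟨g, hg⟩ := hP (T.π 0) ⟨_, _, _, T.conflation 0 (by simp)⟩ (f ≫ T.e.inv)
    exact ⟨g, by simp [LeftSequence.aug, reassoc_of% hg]⟩
  · refine Iff.trans ?_ (key 0 (by simpa using Order.one_le_iff_pos.2 hk) f)
    dsimp only
    rw [LeftSequence.aug, ← Category.assoc, ← zero_comp (f := T.e.hom), cancel_mono]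
  · refine Iff.trans ?_ (key (i + 1) (by exact_mod_cast Order.add_one_le_of_lt hi) f)
    have : Mono (T.ι i) := Inflation.mono ⟨_, _, _, T.conflation i (le_trans (by simp) hi.le)⟩
    dsimp only
    rw [LeftSequence.d, ← Category.assoc, ← zero_comp (f := T.ι i), cancel_mono]

/-- Each `B (i + 1) ⟶ Z i` is a deflation because a deflation from a projective onto `Z i` lifts
through it; its kernel is the next syzygy. -/
lemma exists_conflations [HasBinaryBiproducts E] (hE : WeaklyIdempotentComplete E)
    (hS : S.HasEnoughProjectives)
    (B : ℕ → E) (m : ∀ i, B (i + 1) ⟶ B i)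
    (h₀ : ∀ P, S.IsProjective P → Function.Surjective (fun f : P ⟶ B 1 => f ≫ m 0))
    (h₁ : ∀ P, S.IsProjective P → ∀ i : ℕ, (i : ℕ∞) < k →
      Function.Exact (fun f : P ⟶ B (i + 2) => f ≫ m (i + 1)) (fun f : P ⟶ B (i + 1) => f ≫ m i)) :
    ∃ (Z : ℕ → E) (e : Z 0 ≅ B 0) (ι : ∀ i, Z (i + 1) ⟶ B (i + 1)) (π : ∀ i, B (i + 1) ⟶ Z i)
      (w : ∀ i, ι i ≫ π i = 0),
      (∀ i : ℕ, (i : ℕ∞) ≤ k → S.Conflation (ShortComplex.mk (ι i) (π i) (w i))) ∧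
      π 0 ≫ e.hom = m 0 ∧ ∀ i : ℕ, ((i + 1 : ℕ) : ℕ∞) ≤ k → π (i + 1) ≫ ι i = m (i + 1) := by
  have hm (i : ℕ) (hi : (i : ℕ∞) < k) : m (i + 1) ≫ m i = 0 := by
    obtain ⟨P, p, hP, hp⟩ := hS (B (i + 2))
    have := hp.epi
    rw [← cancel_epi p, ← Category.assoc, comp_zero]
    exact (h₁ P hP i hi _).2 ⟨p, rfl⟩
  -- Invariant of the recursion: the map to the current syzygy is a deflation that kills the same
  -- maps as `m i`. Past `k` it is void, and a zero map fills in.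
  let good (i : ℕ) (s : Σ Z : E, B (i + 1) ⟶ Z) : Prop := (i : ℕ∞) ≤ k →
    S.Deflation s.2 ∧ ∀ {N : E} (f : N ⟶ B (i + 1)), f ≫ s.2 = 0 ↔ f ≫ m i = 0
  have step (i : ℕ) (s : { s // good i s }) : ∃ (t : { t // good (i + 1) t })
      (ι : t.1.1 ⟶ B (i + 1)) (w : ι ≫ s.1.2 = 0),
      ((i : ℕ∞) ≤ k → S.Conflation (ShortComplex.mk ι s.1.2 w)) ∧
      (((i + 1 : ℕ) : ℕ∞) ≤ k → t.1.2 ≫ ι = m (i + 1)) := by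
    obtain ⟨⟨Z, π⟩, hs⟩ := s
    by_cases hi : (i : ℕ∞) ≤ k
    swap
    · have hi' : ¬ ((i + 1 : ℕ) : ℕ∞) ≤ k := fun h => hi (le_trans (by simp) h)
      exact ⟨⟨⟨Z, 0⟩, fun h => absurd h hi'⟩, 0, zero_comp, fun h => absurd h hi,
        fun h => absurd h hi'⟩
    obtain ⟨⟨K, ι, w, hc⟩, hs⟩ := hs hi
    by_cases hi' : ((i + 1 : ℕ) : ℕ∞) ≤ k
    swap
    · exact ⟨⟨⟨K, 0⟩, fun h => absurd h hi'⟩, ι, w, fun _ => hc, fun h => absurd h hi'⟩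
    have hik : (i : ℕ∞) < k := lt_of_lt_of_le (by exact_mod_cast Nat.lt_succ_self i) hi'
    obtain ⟨π', hπ'⟩ := Conflation.exists_lift hc (m (i + 1)) ((hs _).2 (hm i hik))
    dsimp at π' hπ'
    have : Mono ι := Inflation.mono ⟨_, _, _, hc⟩
    refine ⟨⟨⟨K, π'⟩, fun _ => ⟨?_, fun f => ?_⟩⟩, ι, w, fun _ => hc, fun _ => hπ'⟩
    · obtain ⟨P, p, hP, hp⟩ := hS K
      obtain ⟨g, hg⟩ := (h₁ P hP i hik (p ≫ ι)).1 ((hs _).1 (by rw [Category.assoc, w, comp_zero]))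
      refine Deflation.of_comp hE (g := g) ?_
      have : g ≫ π' = p := by
        rw [← cancel_mono ι, Category.assoc, hπ']
        exact hg
      rwa [this]
    · dsimp only
      rw [← hπ', ← Category.assoc, ← zero_comp (f := ι), cancel_mono]
  choose t ι w hc hι using step
  have h0 : good 0 ⟨B 0, m 0⟩ := fun _ => by
    refine ⟨?_, fun f => Iff.rfl⟩
    obtain ⟨P, p, hP, hp⟩ := hS (B 0)
    obtain ⟨g, hg⟩ := h₀ P hP p
    exact Deflation.of_comp hE (g := g) (by rwa [← hg] at hp)
  let s (i : ℕ) : { s // good i s } := Nat.rec ⟨_, h0⟩ (fun i s => t i s) i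
  exact ⟨fun i => (s i).1.1, Iso.refl _, fun i => ι i (s i), fun i => (s i).1.2, fun i => w i (s i),
    fun i hi => hc i (s i) hi, Category.comp_id _, fun i hi => hι i (s i) hi⟩

/-- This removes conflations from the definition: what remains is a complex in `M` and its two
Hom-tests. -/
theorem gen_iff [HasBinaryBiproducts E] (hE : WeaklyIdempotentComplete E)
    (hS : S.HasEnoughProjectives)
    (M : ObjectProperty E) (X : E) : S.gen k M X ↔
      ∃ (A : ℕ → E) (a : A 0 ⟶ X) (d : ∀ i, A (i + 1) ⟶ A i), (∀ i, M (A i)) ∧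
        (∀ N, M N → IsHomExactLeft k a d N) ∧ ∀ P, S.IsProjective P → IsHomExactLeft k a d P := by
  constructor
  · rintro ⟨T, hT, h⟩
    have (i : ℕ) : ∃ (A : E) (u : A ⟶ T.A i) (v : T.A i ⟶ A), M A ∧
        ((i : ℕ∞) ≤ k → u ≫ v = 𝟙 _ ∧ v ≫ u = 𝟙 _) := by
      by_cases hi : (i : ℕ∞) ≤ k
      · exact ⟨T.A i, 𝟙 _, 𝟙 _, hT i hi, by simp⟩
      -- Terms past `k` need not lie in `M`; `T.A 0` does and replaces them.
      · exact ⟨T.A 0, 0, 0, hT 0 (by simp), fun h => absurd h hi⟩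
    choose A u v hA huv using this
    exact ⟨A, u 0 ≫ T.aug, fun i => u (i + 1) ≫ T.d i ≫ v i, hA,
      fun N hN => IsHomExactLeft.of_iso (h N hN) u v huv,
      fun P hP => (T.isHomExactLeft hP).of_iso u v huv⟩
  · rintro ⟨A, a, d, hA, h, h'⟩
    obtain ⟨Z, e, ι, π, w, hc, h₀, h₁⟩ := exists_conflations (k := k) hE hS
      (fun i => Nat.casesOn i X A)
      (fun i => match i with
        | 0 => a
        | i + 1 => d i)
      (fun P hP => (h' P hP).1)
      (fun P hP i hi => match i with
        | 0 => (h' P hP).2.1 hi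
        | i + 1 => (h' P hP).2.2 i hi)
    exact ⟨⟨A, Z, e, ι, π, w, hc⟩, fun i _ => hA i, fun N hN => (h N hN).congr h₀ h₁⟩

lemma op_isProjective_iff {P : Eᵒᵖ} : S.op.IsProjective P ↔ S.IsInjective P.unop := by
  constructor
  · intro h A B i hi f
    obtain ⟨g, hg⟩ := h i.op (op_deflation_iff _ |>.2 hi) f.op
    exact ⟨g.unop, congrArg Quiver.Hom.unop hg⟩
  · intro h A B i hi f
    obtain ⟨g, hg⟩ := h i.unop ((op_deflation_iff _).1 hi) f.unop
    exact ⟨g.op, congrArg Quiver.Hom.op hg⟩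

lemma HasEnoughInjectives.op (h : S.HasEnoughInjectives) : S.op.HasEnoughProjectives := by
  intro X
  obtain ⟨I, i, hI, hi⟩ := h X.unop
  exact ⟨.op I, i.op, op_isProjective_iff.2 hI, (op_deflation_iff _).2 hi⟩

lemma cogen_iff_op_gen (M : ObjectProperty E) (X : E) :
    S.cogen k M X ↔ S.op.gen k M.op (.op X) := by
  constructor
  · rintro ⟨T, hT, h⟩
    let T' : S.op.LeftSequence k (.op X) :=
      { A := fun i => .op (T.A i)
        Z := fun i => .op (T.Z i)
        e := T.e.op
        ι := fun i => (T.π i).op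
        π := fun i => (T.ι i).op
        w := fun i => congrArg Quiver.Hom.op (T.w i)
        conflation := fun i hi => T.conflation i hi }
    exact ⟨T', fun i hi => hT i hi, fun N hN =>
      isHomExactLeft_op_iff (a := T.coaug) (d := T.d).2 (h N.unop hN)⟩
  · rintro ⟨T, hT, h⟩
    let T' : S.RightSequence k X :=
      { A := fun i => (T.A i).unop
        Z := fun i => (T.Z i).unop
        e := T.e.unop
        ι := fun i => (T.π i).unop
        π := fun i => (T.ι i).unop
        w := fun i => congrArg Quiver.Hom.unop (T.w i)
        conflation := fun i hi => T.conflation i hi }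
    exact ⟨T', fun i hi => hT i hi, fun N hN =>
      isHomExactLeft_op_iff (a := T'.coaug) (d := T'.d).1 (h (.op N) hN)⟩

theorem cogen_iff [HasBinaryBiproducts E] (hE : WeaklyIdempotentComplete E)
    (hS : S.HasEnoughInjectives)
    (M : ObjectProperty E) (X : E) : S.cogen k M X ↔
      ∃ (A : ℕ → E) (a : X ⟶ A 0) (d : ∀ i, A i ⟶ A (i + 1)), (∀ i, M (A i)) ∧
        (∀ N, M N → IsHomExactRight k a d N) ∧ ∀ I, S.IsInjective I → IsHomExactRight k a d I := by
  rw [cogen_iff_op_gen, gen_iff hE.op hS.op]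
  constructor
  · rintro ⟨A, a, d, hA, h, h'⟩
    exact ⟨fun i => (A i).unop, a.unop, fun i => (d i).unop, hA,
      fun N hN => isHomExactLeft_op_iff.1 (h (.op N) hN),
      fun I hI => isHomExactLeft_op_iff.1 (h' (.op I) (op_isProjective_iff.2 hI))⟩
  · rintro ⟨A, a, d, hA, h, h'⟩
    exact ⟨fun i => .op (A i), a.op, fun i => (d i).op, hA,
      fun N hN => isHomExactLeft_op_iff.2 (h N.unop hN),
      fun I hI => isHomExactLeft_op_iff.2 (h' I.unop (op_isProjective_iff.1 hI))⟩

end ExactStructure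

end Sequences

/-! ### Hom-exactness, the composition map and Tor -/

section Characterization

open Opposite

/-- `q` is a cokernel of `p`, so `φ` is bijective exactly when `φ ∘ q` is a cokernel of `p` too. -/
lemma bijective_iff_of_exact {A B C D : Type*} [AddGroup C] [AddGroup D] {p : A → B} {q : B → C}
    (h : Function.Exact p q) (hq : Function.Surjective q) (φ : C →+ D) :
    Function.Bijective φ ↔
      Function.Surjective (fun b => φ (q b)) ∧ Function.Exact p (fun b => φ (q b)) := by
  constructor
  · intro hφ
    exact ⟨hφ.2.comp hq, fun b => (map_eq_zero_iff φ hφ.1).trans (h b)⟩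
  · rintro ⟨h₁, h₂⟩
    refine ⟨(injective_iff_map_eq_zero φ).2 fun c hc => ?_, .of_comp h₁⟩
    obtain ⟨b, rfl⟩ := hq c
    exact (h b).2 ((h₂ b).1 hc)

variable {E : Type u} [Category.{v} E] [Preadditive E] {M : ObjectProperty E} {k : ℕ∞} {X : E}

lemma compositionMap_tmul {X Y : E} {N : M.FullSubcategory} (g : (Phi M X).obj.obj (op N))
    (f : (Psi M Y).obj.obj N) :
    compositionMap M X Y (tmul g f) = (ULift.down f : Y ⟶ N.obj) ≫ (ULift.down g : N.obj ⟶ X) :=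
  tensorLift_tmul _ _ _ _ _ _

section Left

variable {c : ℕ → M.FullSubcategoryᵒᵖ} {δ : ∀ i, c i ⟶ c (i + 1)}
  {x : (Phi M X).obj.obj (c 0)}

lemma phi_isRepresentablePresentation_iff :
    LeftMod.IsRepresentablePresentation k (Phi M X) c δ x ↔
      ∀ N, M N → IsHomExactLeft k (A := fun i => (c i).unop.obj) (ULift.down x)
        (fun i => (δ i).unop.hom) N := by
  have hb (i : ℕ) (N : M.FullSubcategoryᵒᵖ) : Function.Bijective
      (fun f : c i ⟶ N => (f.unop.hom : N.unop.obj ⟶ (c i).unop.obj)) :=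
    ⟨fun f g h => Quiver.Hom.unop_inj (ObjectProperty.hom_ext _ h),
      fun f => ⟨(ObjectProperty.homMk f).op, rfl⟩⟩
  have e (N : M.FullSubcategoryᵒᵖ) :
      IsHomExactLeft k (A := fun i => (c i).unop.obj) (ULift.down x)
        (fun i => (δ i).unop.hom) N.unop.obj ↔
      Function.Surjective (fun f : c 0 ⟶ N => (Phi M X).obj.map f x) ∧
      (0 < k → Function.Exact (fun f : c 1 ⟶ N => δ 0 ≫ f)
        (fun f : c 0 ⟶ N => (Phi M X).obj.map f x)) ∧
      ∀ i : ℕ, ((i + 1 : ℕ) : ℕ∞) < k → Function.Exact (fun f : c (i + 2) ⟶ N => δ (i + 1) ≫ f)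
        (fun f : c (i + 1) ⟶ N => δ i ≫ f) := by
    refine and_congr ?_ (and_congr (forall_congr' fun hk => ?_)
      (forall_congr' fun i => forall_congr' fun hi => ?_))
    · constructor
      · intro h y
        obtain ⟨f, hf⟩ := h (ULift.down y)
        exact ⟨(ObjectProperty.homMk f).op, ULift.ext _ _ hf⟩
      · intro h y
        obtain ⟨f, hf⟩ := h ⟨y⟩
        exact ⟨f.unop.hom, congrArg ULift.down hf⟩
    · exact (Function.Exact.iff_of_bijective_ladder _ _
        (AddEquiv.ulift : ULift.{max u v} (N.unop.obj ⟶ X) ≃+ _).toAddMonoidHom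
        (hb 1 N).2 (hb 0 N) AddEquiv.ulift.injective (fun _ => rfl) (fun _ => rfl)).symm
    · exact (Function.Exact.iff_of_bijective_ladder _ _
        (AddMonoidHom.mk' (fun f : c i ⟶ N => (f.unop.hom : N.unop.obj ⟶ (c i).unop.obj))
          fun _ _ => rfl)
        (hb (i + 2) N).2 (hb (i + 1) N) (hb i N).1 (fun _ => rfl) (fun _ => rfl)).symm
  constructor
  · intro h N hN
    exact (e (op ⟨N, hN⟩)).2 ⟨h.1 _, fun hk => h.2.1 hk _, fun i hi => h.2.2 i hi _⟩
  · intro h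
    have h' (N) := (e N).1 (h _ N.unop.property)
    exact ⟨fun N => (h' N).1, fun hk N => (h' N).2.1 hk, fun i hi N => (h' N).2.2 i hi⟩

/-- The presentation tensored with `Ψ(P)` is the complex `Hom(P, A i)`. Surjectivity and exactness
at `A 0` match bijectivity of the composition map, and exactness at `A (i + 1)` matches vanishing of
Tor in degree `i + 1`. -/
lemma isHomExactLeft_iff_bijective_and_isZero_torMod (hk : 1 ≤ k)
    (h : LeftMod.IsRepresentablePresentation k (Phi M X) c δ x) (P : E) :
    IsHomExactLeft k (A := fun i => (c i).unop.obj) (ULift.down x) (fun i => (δ i).unop.hom) P ↔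
      Function.Bijective (compositionMap M X P) ∧
        ∀ i : ℕ, 1 ≤ i → (i : ℕ∞) < k → IsZero (TorMod i (Phi M X) (Psi M P)) := by
  -- The presentation must reach `A 1` for the tensor product to be a cokernel; this is where `1 ≤
  -- k` enters.
  have hk' : 0 < k := Order.one_le_iff_pos.1 hk
  have hu (Y Z : E) : Function.Bijective (ULift.up : (Y ⟶ Z) → ULift.{max u v} (Y ⟶ Z)) :=
    ULift.up_bijective
  rw [bijective_iff_of_exact (h.exact_tmul_left (Psi M P) hk') (h.tmul_surjective_left (Psi M P)),
    and_assoc]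
  refine and_congr ?_ (and_congr ?_ ?_)
  · constructor
    · intro h' f
      obtain ⟨g, hg⟩ := h' f
      exact ⟨⟨g⟩, (compositionMap_tmul _ _).trans hg⟩
    · intro h' f
      obtain ⟨g, hg⟩ := h' f
      exact ⟨ULift.down g, (compositionMap_tmul _ _).symm.trans hg⟩
  · rw [forall_prop_of_true hk']
    exact Function.Exact.iff_of_bijective_ladder _ _ (AddMonoidHom.id _) (hu _ _).2 (hu _ _)
      Function.injective_id (fun _ => rfl) (fun _ => (compositionMap_tmul _ _).symm)
  · have e (i : ℕ) (hi : ((i + 1 : ℕ) : ℕ∞) < k) :=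
      (Function.Exact.iff_of_bijective_ladder
        (f := fun f : P ⟶ (c (i + 2)).unop.obj => f ≫ (δ (i + 1)).unop.hom)
        (g := fun f : P ⟶ (c (i + 1)).unop.obj => f ≫ (δ i).unop.hom) _ _
        (AddEquiv.ulift.symm : (P ⟶ (c i).unop.obj) ≃+ ULift.{max u v} _).toAddMonoidHom
        (hu _ _).2 (hu _ _) AddEquiv.ulift.symm.injective (fun _ => rfl) (fun _ => rfl)).trans
      (h.torMod_isZero_iff_left (Psi M P) i hi).symm
    constructor
    · rintro h' (_ | i) h₁ hi
      · exact absurd h₁ (by simp)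
      · exact (e i hi).1 (h' i hi)
    · exact fun h' i hi => (e i hi).2 (h' (i + 1) (by simp) hi)

end Left

section Right

variable {c : ℕ → M.FullSubcategory} {δ : ∀ i, c i ⟶ c (i + 1)} {x : (Psi M X).obj.obj (c 0)}

lemma psi_isRepresentablePresentation_iff :
    LeftMod.IsRepresentablePresentation k (Psi M X) c δ x ↔
      ∀ N, M N → IsHomExactRight k (A := fun i => (c i).obj) (ULift.down x)
        (fun i => (δ i).hom) N := by
  have hb (i : ℕ) (N : M.FullSubcategory) : Function.Bijective
      (fun f : c i ⟶ N => (f.hom : (c i).obj ⟶ N.obj)) :=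
    ⟨fun f g h => ObjectProperty.hom_ext _ h, fun f => ⟨ObjectProperty.homMk f, rfl⟩⟩
  have e (N : M.FullSubcategory) :
      IsHomExactRight k (A := fun i => (c i).obj) (ULift.down x) (fun i => (δ i).hom) N.obj ↔
      Function.Surjective (fun f : c 0 ⟶ N => (Psi M X).obj.map f x) ∧
      (0 < k → Function.Exact (fun f : c 1 ⟶ N => δ 0 ≫ f)
        (fun f : c 0 ⟶ N => (Psi M X).obj.map f x)) ∧
      ∀ i : ℕ, ((i + 1 : ℕ) : ℕ∞) < k → Function.Exact (fun f : c (i + 2) ⟶ N => δ (i + 1) ≫ f)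
        (fun f : c (i + 1) ⟶ N => δ i ≫ f) := by
    refine and_congr ?_ (and_congr (forall_congr' fun hk => ?_)
      (forall_congr' fun i => forall_congr' fun hi => ?_))
    · constructor
      · intro h y
        obtain ⟨f, hf⟩ := h (ULift.down y)
        exact ⟨ObjectProperty.homMk f, ULift.ext _ _ hf⟩
      · intro h y
        obtain ⟨f, hf⟩ := h ⟨y⟩
        exact ⟨f.hom, congrArg ULift.down hf⟩
    · exact (Function.Exact.iff_of_bijective_ladder _ _
        (AddEquiv.ulift : ULift.{max u v} (X ⟶ N.obj) ≃+ _).toAddMonoidHom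
        (hb 1 N).2 (hb 0 N) AddEquiv.ulift.injective (fun _ => rfl) (fun _ => rfl)).symm
    · exact (Function.Exact.iff_of_bijective_ladder _ _
        (AddMonoidHom.mk' (fun f : c i ⟶ N => (f.hom : (c i).obj ⟶ N.obj)) fun _ _ => rfl)
        (hb (i + 2) N).2 (hb (i + 1) N) (hb i N).1 (fun _ => rfl) (fun _ => rfl)).symm
  constructor
  · intro h N hN
    exact (e ⟨N, hN⟩).2 ⟨h.1 _, fun hk => h.2.1 hk _, fun i hi => h.2.2 i hi _⟩
  · intro h
    have h' (N) := (e N).1 (h _ N.property)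
    exact ⟨fun N => (h' N).1, fun hk N => (h' N).2.1 hk, fun i hi N => (h' N).2.2 i hi⟩

/-- Here the second tensor factor is presented, so the balanced description of Tor is used. -/
lemma isHomExactRight_iff_bijective_and_isZero_torMod (hk : 1 ≤ k)
    (h : LeftMod.IsRepresentablePresentation k (Psi M X) c δ x) (I : E) :
    IsHomExactRight k (A := fun i => (c i).obj) (ULift.down x) (fun i => (δ i).hom) I ↔
      Function.Bijective (compositionMap M I X) ∧
        ∀ i : ℕ, 1 ≤ i → (i : ℕ∞) < k → IsZero (TorMod i (Phi M I) (Psi M X)) := by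
  have hk' : 0 < k := Order.one_le_iff_pos.1 hk
  have hu (Y Z : E) : Function.Bijective (ULift.up : (Y ⟶ Z) → ULift.{max u v} (Y ⟶ Z)) :=
    ULift.up_bijective
  rw [bijective_iff_of_exact (h.exact_tmul_right (Phi M I) hk')
    (h.tmul_surjective_right (Phi M I)), and_assoc]
  refine and_congr ?_ (and_congr ?_ ?_)
  · constructor
    · intro h' f
      obtain ⟨g, hg⟩ := h' f
      exact ⟨⟨g⟩, (compositionMap_tmul _ _).trans hg⟩
    · intro h' f
      obtain ⟨g, hg⟩ := h' f
      exact ⟨ULift.down g, (compositionMap_tmul _ _).symm.trans hg⟩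
  · rw [forall_prop_of_true hk']
    exact Function.Exact.iff_of_bijective_ladder _ _ (AddMonoidHom.id _) (hu _ _).2 (hu _ _)
      Function.injective_id (fun _ => rfl) (fun _ => (compositionMap_tmul _ _).symm)
  · have e (i : ℕ) (hi : ((i + 1 : ℕ) : ℕ∞) < k) :=
      (Function.Exact.iff_of_bijective_ladder
        (f := fun f : (c (i + 2)).obj ⟶ I => (δ (i + 1)).hom ≫ f)
        (g := fun f : (c (i + 1)).obj ⟶ I => (δ i).hom ≫ f) _ _
        (AddEquiv.ulift.symm : ((c i).obj ⟶ I) ≃+ ULift.{max u v} _).toAddMonoidHom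
        (hu _ _).2 (hu _ _) AddEquiv.ulift.symm.injective (fun _ => rfl) (fun _ => rfl)).trans
      (h.torMod_isZero_iff_right (Phi M I) i hi).symm
    constructor
    · rintro h' (_ | i) h₁ hi
      · exact absurd h₁ (by simp)
      · exact (e i hi).1 (h' i hi)
    · exact fun h' i hi => (e i hi).2 (h' (i + 1) (by simp) hi)

end Right

end Characterization

theorem mainTheorem3 {E : Type u} [Category.{v} E] [Preadditive E] [HasFiniteBiproducts E]
    (S : ExactStructure E) (hE : WeaklyIdempotentComplete E)
    (M : ObjectProperty E) [HasFiniteBiproducts M.FullSubcategory]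
    (k : ℕ∞) (hk : 1 ≤ k) (X : E) :
    (S.HasEnoughProjectives →
      (S.gen k M X ↔
        (Phi M X).IsPresented k ∧
        ∀ P : E, S.IsProjective P →
          Function.Bijective (compositionMap M X P) ∧
          ∀ i : ℕ, 1 ≤ i → (i : ℕ∞) < k → IsZero (TorMod i (Phi M X) (Psi M P)))) ∧
    (S.HasEnoughInjectives →
      (S.cogen k M X ↔
        (Psi M X).IsPresented k ∧
        ∀ I : E, S.IsInjective I →
          Function.Bijective (compositionMap M I X) ∧
          ∀ i : ℕ, 1 ≤ i → (i : ℕ∞) < k → IsZero (TorMod i (Phi M I) (Psi M X)))) := by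
  have := hasBinaryBiproducts_of_finite_biproducts E
  refine ⟨fun hS => ?_, fun hS => ?_⟩
  · rw [ExactStructure.gen_iff hE hS]
    constructor
    · rintro ⟨A, a, d, hA, h, h'⟩
      have hp := (phi_isRepresentablePresentation_iff (M := M)
        (c := fun i => .op ⟨A i, hA i⟩) (δ := fun i => (ObjectProperty.homMk (d i)).op)
        (x := ⟨a⟩)).2 h
      exact ⟨hp.isPresented, fun P hP =>
        (isHomExactLeft_iff_bijective_and_isZero_torMod hk hp P).1 (h' P hP)⟩
    · rintro ⟨hp, h⟩
      -- `Φ(X)` is a left module over the opposite of `M`, which must have biproducts for covers by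
      -- single representables.
      have : HasFiniteBiproducts M.FullSubcategoryᵒᵖ := .of_hasFiniteProducts
      obtain ⟨c, δ, x, hp⟩ := hp.exists_isRepresentablePresentation
      exact ⟨_, _, _, fun i => (c i).unop.property, phi_isRepresentablePresentation_iff.1 hp,
        fun P hP => (isHomExactLeft_iff_bijective_and_isZero_torMod hk hp P).2 (h P hP)⟩
  · rw [ExactStructure.cogen_iff hE hS]
    constructor
    · rintro ⟨A, a, d, hA, h, h'⟩
      have hp := (psi_isRepresentablePresentation_iff (M := M)
        (c := fun i => ⟨A i, hA i⟩) (δ := fun i => ObjectProperty.homMk (d i)) (x := ⟨a⟩)).2 h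
      exact ⟨hp.isPresented, fun I hI =>
        (isHomExactRight_iff_bijective_and_isZero_torMod hk hp I).1 (h' I hI)⟩
    · rintro ⟨hp, h⟩
      obtain ⟨c, δ, x, hp⟩ := hp.exists_isRepresentablePresentation
      exact ⟨_, _, _, fun i => (c i).property, psi_isRepresentablePresentation_iff.1 hp,
        fun I hI => (isHomExactRight_iff_bijective_and_isZero_torMod hk hp I).2 (h I hI)⟩
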